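/- Let $\alpha,\lambda\in\mathbb C$, $\alpha\neq 0$, and suppose that either $\lambda=\alpha$ and $\alpha\notin\mathbb N=\{0,1,2,\dots\}$, or $\lambda=1$ and $\alpha^{-1}\notin\mathbb N$. *The Lie superalgebra.* Let $D_\alpha$ be the Jordan superalgebra with even basis $e_1,e_2$, odd basis $\xi,\eta$ and product $e_ie_i=e_i$, $e_1e_2=0$, $e_i\xi=\frac12\xi$, $e_i\eta=\frac12\eta$, $\xi\eta=e_1+\alpha e_2$ (supercommutative), with multiplication operators $L_a$ and unit $e=e_1+e_2$. Put $\mathfrak{str}=\langle L_a\rangle\oplus\mathrm{Der}(D_\alpha)$ and let $\mathfrak g=D_\alpha^-\oplus\mathfrak{str}\oplus D_\alpha^+\cong D(2,1;\alpha)$ be the Lie superalgebra over $\mathbb C$ in which $\mathfrak{str}\subset\mathrm{End}(D_\alpha)$ carries the supercommutator and, for $x,y\in D_\alpha^+$, $u,v\in D_\alpha^-$, $a\in D_\alpha$, $I\in \mathrm{Der}(D_\alpha)$, $$[L_a,x]=ax,\quad [I,x]=Ix,\quad [L_a,u]=-au,\quad [I,u]=Iu,\quad [x,u]=2L_{xu}+2[L_x,L_u],\quad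 [x,y]=0=[u,v].$$ Let $U(\mathfrak g)$ be its universal enveloping algebra and $U_k(\mathfrak g)=(\mathbb C\oplus\mathfrak g)^k$ its canonical filtration. Write $e\in D_\alpha^+$ and $f\in D_\alpha^-$ for the two copies of the unit and let $c=\exp(\frac{\imath}{2}\operatorname{ad} f)\exp(\imath\operatorname{ad} e)\in\mathrm{End}(\mathfrak g)$ be the Cayley transform. *The Fock representation.* Let $\mathcal P=\mathcal P(\mathbb C^{2|2})$ be the superpolynomials in even variables $z_1,z_2$ and odd variables $z_3,z_4$, with left partial derivatives $\partial_i$, and identify the basis of $D_\alpha^-$ corresponding to $e_1,e_2,\xi,\eta$ with $z_1,z_2,z_3,z_4$. Define the Bessel operators, extended linearly to $D_\alpha^+$ by $e_1,e_2,\xi,\eta\leftrightarrow z_1,z_2,z_3,z_4$, by $$\begin{aligned} \mathcal B(z_1)&=(-\lambda+z_1\partial_1+z_3\partial_3+z_4\partial_4)\partial_1-2\alpha z_2\partial_3\partial_4,\\ \mathcal B(z_2)&=(-\tfrac{\lambda}{\alpha}+z_2\partial_2+z_3\partial_3+z_4\partial_4)\partial_2-2z_1\partial_3\partial_4,\\ \mathcal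 B(z_3)&=(-2\lambda+2z_1\partial_1+2\alpha z_2\partial_2+2(1+\alpha)z_3\partial_3)\partial_4+z_3\partial_1\partial_2,\\ \mathcal B(z_4)&=(2\lambda-2z_1\partial_1-2\alpha z_2\partial_2-2(1+\alpha)z_4\partial_4)\partial_3+z_4\partial_1\partial_2. \end{aligned}$$ Let $\chi$ be the linear form on $\mathfrak{str}$ with $\chi(2L_{e_1})=\lambda$, $\chi(2L_{e_2})=\lambda/\alpha$ and $\chi(L_\xi)=\chi(L_\eta)=\chi(\mathrm{Der}(D_\alpha))=0$. Put $\pi_\lambda(u)=-2\imath u$ for $u\in D_\alpha^-$, $\pi_\lambda(T)=\chi(T)+\sum_j[T,z_j]\partial_j$ for $T\in\mathfrak{str}$, $\pi_\lambda(x)=-\frac{\imath}{2}\mathcal B(x)$ for $x\in D_\alpha^+$, and $\rho_\lambda=\pi_\lambda\circ c$. Let $\mathcal I_\lambda\subset\mathcal P$ be the ideal generated by $2z_1z_2+z_3z_4,\ z_2^2,\ z_2z_3,\ z_2z_4$ if $\lambda=\alpha$, and by $2\alpha z_1z_2+z_3z_4,\ z_1^2,\ z_1z_3,\ z_1z_4$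 if $\lambda=1$. *Gelfand–Kirillov dimension.* For a finitely generated module $M$ over a finitely generated $\mathbb C$-algebra $R$, $GK(M)=\limsup_{k\to\infty}\log_k\dim(V^kM_0)$, where $V\subset R$ is a finite-dimensional subspace that contains $1$ and generates $R$, and $M_0\subset M$ is a finite-dimensional subspace that generates $M$; "$GK(M)=d$" means that this limsup equals $d$ for every choice of $(V,M_0)$, and that such pairs exist. **Claim.** $\rho_\lambda$ induces a (unique) $U(\mathfrak g)$-module structure on $\mathcal P/\mathcal I_\lambda$. For its submodule $F_\lambda=U(\mathfrak g)\cdot 1$, with $F_{\lambda,0}=\mathbb C\cdot 1$, $$GK(F_\lambda)=1,\qquad \dim U_k(\mathfrak g)F_{\lambda,0}=1+4k\quad(k\ge 0),$$ and $F_\lambda$ is infinite-dimensional. The value $1$ is the minimal possible one: for every infinite-dimensional finitely generated $U(\mathfrak g)$-module $M$ and all $V$, $M_0$ as above, $\limsup_{k\to\infty}\log_k\dim(V^kM_0)\ge 1$. -/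

import Mathlib

open scoped TensorProduct

noncomputable section

namespace D21

/-! ### The Jordan superalgebra `D_α` over `ℂ`

The basis `(e₁, e₂, ξ, η)` is indexed by `0, 1, 2, 3`; the last two basis vectors are odd. -/

/-- The underlying space of `D_α`. -/
abbrev J : Type := Fin 4 → ℂ

/-- An index is odd when it belongs to `ξ` or `η`. -/
def isOdd (i : Fin 4) : Prop := 2 ≤ i

instance : DecidablePred isOdd := fun i => inferInstanceAs (Decidable (2 ≤ i))

/-- The Jordan product: `eᵢ eᵢ = eᵢ`, `e₁ e₂ = 0`, `eᵢ ξ = ξ / 2`, `eᵢ η = η / 2`,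
`ξ η = e₁ + α e₂ = - η ξ`, extended bilinearly and supercommutatively. -/
def jmul (α : ℂ) (x y : J) : J :=
  ![x 0 * y 0 + (x 2 * y 3 - x 3 * y 2),
    x 1 * y 1 + α * (x 2 * y 3 - x 3 * y 2),
    ((x 0 + x 1) * y 2 + x 2 * (y 0 + y 1)) / 2,
    ((x 0 + x 1) * y 3 + x 3 * (y 0 + y 1)) / 2]

/-- The unit `e = e₁ + e₂`. -/
def jone : J := ![1, 1, 0, 0]

/-- Endomorphisms of `D_α`, as matrices with respect to `(e₁, e₂, ξ, η)`. -/
abbrev EndJ : Type := Matrix (Fin 4) (Fin 4) ℂ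

/-- The operator `L_x` of left multiplication by `x`. -/
def L (α : ℂ) (x : J) : EndJ := Matrix.of fun i j => jmul α x (Pi.single j 1) i

/-- The odd component of a vector. -/
def oddV (x : J) : J := fun i => if isOdd i then x i else 0

/-- The odd component of an endomorphism: the part that exchanges the parities. -/
def oddM (T : EndJ) : EndJ := Matrix.of fun i j => if isOdd i ↔ isOdd j then 0 else T i j

/-- The supercommutator `[T, S] = T S - (-1)^{|T||S|} S T`, extended bilinearly: the sign changes
only for the product of the two odd components. -/
def scomm (T S : EndJ) : EndJ := T * S - S * T + (2 : ℂ) • (oddM S * oddM T)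

/-- The vector `(-1)^{|S||x|} S x`, extended bilinearly. -/
def flipAct (S : EndJ) (x : J) : J := S.mulVec x - (2 : ℂ) • (oddM S).mulVec (oddV x)

lemma jmul_add_left (α : ℂ) (x y z : J) : jmul α (x + y) z = jmul α x z + jmul α y z := by
  ext i; fin_cases i <;> simp [jmul] <;> ring

lemma jmul_smul_left (α c : ℂ) (x z : J) : jmul α (c • x) z = c • jmul α x z := by
  ext i; fin_cases i <;> simp [jmul] <;> ring

lemma jmul_add_right (α : ℂ) (x y z : J) : jmul α x (y + z) = jmul α x y + jmul α x z := by
  ext i; fin_cases i <;> simp [jmul] <;> ring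

lemma jmul_smul_right (α c : ℂ) (x z : J) : jmul α x (c • z) = c • jmul α x z := by
  ext i; fin_cases i <;> simp [jmul] <;> ring

lemma L_add (α : ℂ) (x y : J) : L α (x + y) = L α x + L α y := by
  ext i j; simp [L, jmul_add_left]

lemma L_smul (α c : ℂ) (x : J) : L α (c • x) = c • L α x := by
  ext i j; simp [L, jmul_smul_left]

lemma oddV_add (x y : J) : oddV (x + y) = oddV x + oddV y := by
  ext i; simp only [oddV, Pi.add_apply]; split_ifs <;> simp

lemma oddV_smul (c : ℂ) (x : J) : oddV (c • x) = c • oddV x := by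
  ext i; simp only [oddV, Pi.smul_apply]; split_ifs <;> simp

lemma oddM_add (T S : EndJ) : oddM (T + S) = oddM T + oddM S := by
  ext i j; simp only [oddM, Matrix.of_apply, Matrix.add_apply]; split_ifs <;> simp

lemma oddM_smul (c : ℂ) (T : EndJ) : oddM (c • T) = c • oddM T := by
  ext i j; simp only [oddM, Matrix.of_apply, Matrix.smul_apply]; split_ifs <;> simp

lemma scomm_add_left (T T' S : EndJ) : scomm (T + T') S = scomm T S + scomm T' S := by
  simp only [scomm, oddM_add, add_mul, mul_add, smul_add]; abel

lemma scomm_add_right (T S S' : EndJ) : scomm T (S + S') = scomm T S + scomm T S' := by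
  simp only [scomm, oddM_add, add_mul, mul_add, smul_add]; abel

lemma scomm_smul_left (c : ℂ) (T S : EndJ) : scomm (c • T) S = c • scomm T S := by
  simp only [scomm, oddM_smul, smul_mul_assoc, mul_smul_comm, smul_add, smul_sub,
    smul_comm c (2 : ℂ)]

lemma scomm_smul_right (c : ℂ) (T S : EndJ) : scomm T (c • S) = c • scomm T S := by
  simp only [scomm, oddM_smul, smul_mul_assoc, mul_smul_comm, smul_add, smul_sub,
    smul_comm c (2 : ℂ)]

lemma flipAct_add (S : EndJ) (x y : J) : flipAct S (x + y) = flipAct S x + flipAct S y := by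
  simp only [flipAct, oddV_add, Matrix.mulVec_add, smul_add]; abel

lemma flipAct_smul (c : ℂ) (S : EndJ) (x : J) : flipAct S (c • x) = c • flipAct S x := by
  simp only [flipAct, oddV_smul, Matrix.mulVec_smul, smul_sub, smul_comm c (2 : ℂ)]

lemma flipAct_add_left (S S' : EndJ) (x : J) :
    flipAct (S + S') x = flipAct S x + flipAct S' x := by
  simp only [flipAct, oddM_add, Matrix.add_mulVec, smul_add]; abel

lemma flipAct_smul_left (c : ℂ) (S : EndJ) (x : J) : flipAct (c • S) x = c • flipAct S x := by
  simp only [flipAct, oddM_smul, Matrix.smul_mulVec, smul_sub, smul_comm c (2 : ℂ)]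

/-! ### The structure algebra -/

/-- `Der(D_α)`: the endomorphisms `D` with `[D, L_x] = L_{D x}` for all `x`. -/
def der (α : ℂ) : Submodule ℂ EndJ where
  carrier := {D | ∀ x : J, scomm D (L α x) = L α (D.mulVec x)}
  add_mem' := by
    intro D D' h h' x
    rw [scomm_add_left, h x, h' x, Matrix.add_mulVec, L_add]
  zero_mem' := by
    intro x
    have h := scomm_smul_left 0 0 (L α x)
    have h' := L_smul α 0 0
    simp only [zero_smul] at h h'
    rw [h, Matrix.zero_mulVec, h']
  smul_mem' := by
    intro c D h x
    rw [scomm_smul_left, h x, Matrix.smul_mulVec, L_smul]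

/-- The space `⟨L_x | x ∈ D_α⟩`. -/
def mulOps (α : ℂ) : Submodule ℂ EndJ := Submodule.span ℂ (Set.range (L α))

/-- The structure algebra `str(D_α) = ⟨L_x⟩ + Der(D_α)`. -/
def str (α : ℂ) : Submodule ℂ EndJ := mulOps α ⊔ der α

lemma L_mem_str (α : ℂ) (x : J) : L α x ∈ str α :=
  Submodule.mem_sup_left (Submodule.subset_span ⟨x, rfl⟩)

/-- The matrix shape of the elements of the structure algebra. -/
def StrShape (α : ℂ) (T : EndJ) : Prop :=
  T 0 1 = 0 ∧ T 1 0 = 0 ∧ T 0 2 = -2 * T 3 1 ∧ T 1 2 = -2 * α * T 3 0 ∧ T 0 3 = 2 * T 2 1 ∧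
    T 1 3 = 2 * α * T 2 0 ∧ T 2 2 + T 3 3 = T 0 0 + T 1 1


lemma L_shape (α : ℂ) (x : J) : StrShape α (L α x) := by
  simp only [StrShape, L, Matrix.of_apply, jmul]
  refine ⟨?_, ?_, ?_, ?_, ?_, ?_, ?_⟩ <;> simp <;> ring

lemma StrShape.add {α : ℂ} {T S : EndJ} (hT : StrShape α T) (hS : StrShape α S) :
    StrShape α (T + S) := by
  obtain ⟨h1, h2, h3, h4, h5, h6, h7⟩ := hT
  obtain ⟨k1, k2, k3, k4, k5, k6, k7⟩ := hS
  simp only [StrShape, Matrix.add_apply]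
  refine ⟨?_, ?_, ?_, ?_, ?_, ?_, ?_⟩ <;> grind

lemma StrShape.smul {α : ℂ} (c : ℂ) {T : EndJ} (hT : StrShape α T) : StrShape α (c • T) := by
  obtain ⟨h1, h2, h3, h4, h5, h6, h7⟩ := hT
  simp only [StrShape, Matrix.smul_apply, smul_eq_mul]
  refine ⟨?_, ?_, ?_, ?_, ?_, ?_, ?_⟩ <;> grind

lemma scomm_apply (T S : EndJ) (i j : Fin 4) :
    scomm T S i j = ∑ k, (T i k * S k j - S i k * T k j +
      2 * ((if isOdd i ↔ isOdd k then 0 else S i k) *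
        (if isOdd k ↔ isOdd j then 0 else T k j))) := by
  simp only [scomm, oddM, Matrix.add_apply, Matrix.sub_apply, Matrix.smul_apply, Matrix.mul_apply,
    Matrix.of_apply, smul_eq_mul, Finset.mul_sum, Finset.sum_add_distrib, Finset.sum_sub_distrib]

lemma odd_table : ¬ isOdd 0 ∧ ¬ isOdd 1 ∧ isOdd 2 ∧ isOdd 3 := by decide

lemma scomm_shape {α : ℂ} {T S : EndJ} (hT : StrShape α T) (hS : StrShape α S) :
    StrShape α (scomm T S) := by
  obtain ⟨h1, h2, h3, h4, h5, h6, h7⟩ := hT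
  obtain ⟨k1, k2, k3, k4, k5, k6, k7⟩ := hS
  obtain ⟨o0, o1, o2, o3⟩ := odd_table
  have h7' : T 3 3 = T 0 0 + T 1 1 - T 2 2 := by grind
  have k7' : S 3 3 = S 0 0 + S 1 1 - S 2 2 := by grind
  simp only [StrShape, scomm_apply, Fin.sum_univ_four, o0, o1, o2, o3, h1, h2, h3, h4, h5, h6, h7',
    k1, k2, k3, k4, k5, k6, k7', if_true, if_false, iff_self, iff_true, iff_false, not_true,
    not_false_iff]
  refine ⟨?_, ?_, ?_, ?_, ?_, ?_, ?_⟩ <;> ring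

lemma der_shape {α : ℂ} {D : EndJ} (hD : D ∈ der α) : StrShape α D := by
  obtain ⟨o0, o1, o2, o3⟩ := odd_table
  have key : ∀ a i j : Fin 4, scomm D (L α (Pi.single a 1)) i j
      = L α (D.mulVec (Pi.single a 1)) i j := fun a i j => by rw [hD]
  simp only [scomm_apply, Fin.sum_univ_four, o0, o1, o2, o3, L, Matrix.of_apply, jmul,
    iff_true, iff_false, Matrix.mulVec_single_one, Matrix.col_apply] at key
  have a1 := key 0 0 0
  have a2 := key 0 0 1
  have a3 := key 0 1 0
  have a4 := key 0 1 1
  have a5 := key 0 0 2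
  have a6 := key 0 1 2
  have a7 := key 0 0 3
  have a8 := key 0 1 3
  have b1 := key 1 0 0
  have b2 := key 1 0 1
  have b3 := key 1 1 0
  have b4 := key 1 1 1
  have b5 := key 1 0 2
  have b6 := key 1 1 2
  have b7 := key 1 0 3
  have b8 := key 1 1 3
  have c1 := key 2 0 3
  have c2 := key 2 0 0
  have c3 := key 2 1 1
  have c4 := key 2 2 2
  have c5 := key 0 2 0
  have c6 := key 0 3 0
  have c7 := key 0 2 1
  have c8 := key 0 3 1
  simp at a1 a2 a3 a4 a5 a6 a7 a8 b1 b2 b3 b4 b5 b6 b7 b8 c1 c2 c3 c4 c5 c6 c7 c8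
  refine ⟨?_, ?_, ?_, ?_, ?_, ?_, ?_⟩ <;> grind

lemma mem_der_of_shape {α : ℂ} {D : EndJ} (hD : StrShape α D) (he : D.mulVec jone = 0) :
    D ∈ der α := by
  obtain ⟨h1, h2, h3, h4, h5, h6, h7⟩ := hD
  obtain ⟨o0, o1, o2, o3⟩ := odd_table
  have e : ∀ i, D i 0 + D i 1 = 0 := fun i => by
    have := congrFun he i
    simpa [Matrix.mulVec, dotProduct, Fin.sum_univ_four, jone] using this
  have e0 : D 0 0 = 0 := by have := e 0; grind
  have e1 : D 1 1 = 0 := by have := e 1; grind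
  have e2 : D 2 1 = - D 2 0 := by have := e 2; grind
  have e3 : D 3 1 = - D 3 0 := by have := e 3; grind
  have h7' : D 3 3 = - D 2 2 := by grind
  intro x
  ext i j
  fin_cases i <;> fin_cases j <;>
  · simp [scomm_apply, Fin.sum_univ_four, o0, o1, o2, o3, L, jmul, Matrix.mulVec, dotProduct,
      h1, h2, h3, h4, h5, h6, h7', e0, e1, e2, e3]
    try ring

lemma L_mulVec_one (α : ℂ) (x : J) : (L α x).mulVec jone = x := by
  ext i; fin_cases i <;>
  · simp [L, jmul, Matrix.mulVec, dotProduct, Fin.sum_univ_four, jone]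
    try ring

lemma mem_str_iff {α : ℂ} {T : EndJ} : T ∈ str α ↔ StrShape α T := by
  constructor
  · intro h
    obtain ⟨A, hA, D, hD, rfl⟩ := Submodule.mem_sup.1 h
    refine StrShape.add ?_ (der_shape hD)
    clear h hD
    induction hA using Submodule.span_induction with
    | mem y hy => obtain ⟨x, rfl⟩ := hy; exact L_shape α x
    | zero => simp [StrShape]
    | add y z _ _ hy hz => exact hy.add hz
    | smul c y _ hy => exact hy.smul c
  · intro h
    have hd : T - L α (T.mulVec jone) ∈ der α := by
      refine mem_der_of_shape ?_ ?_
      · have := h.add ((L_shape α (T.mulVec jone)).smul (-1))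
        rwa [neg_one_smul, ← sub_eq_add_neg] at this
      · rw [Matrix.sub_mulVec, L_mulVec_one, sub_self]
    have := (str α).add_mem (L_mem_str α (T.mulVec jone)) (Submodule.mem_sup_right hd)
    rwa [add_sub_cancel] at this

lemma scomm_mem_str {α : ℂ} {T S : EndJ} (hT : T ∈ str α) (hS : S ∈ str α) :
    scomm T S ∈ str α :=
  mem_str_iff.2 (scomm_shape (mem_str_iff.1 hT) (mem_str_iff.1 hS))

/-! ### The Lie superalgebra `𝔤 = TKK(D_α) ≅ D(2,1;α)` -/

/-- `𝔤 = D_α⁻ ⊕ str(D_α) ⊕ D_α⁺`; an element is a triple `(u, T, x)`. -/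
abbrev G (α : ℂ) : Type := J × str α × J

/-- The action of `str(D_α)` on `D_α⁻`: `L_a` acts by `-L_a` and a derivation `I` acts by `I`.
The `L`-component of `T = L_a + I` is recovered as `a = T e`, because `I e = 0`. -/
def minusAct (α : ℂ) (T : EndJ) : EndJ := T - (2 : ℂ) • L α (T.mulVec jone)

lemma minusAct_add (α : ℂ) (T S : EndJ) : minusAct α (T + S) = minusAct α T + minusAct α S := by
  simp only [minusAct, Matrix.add_mulVec, L_add, smul_add]; abel

lemma minusAct_smul (α c : ℂ) (T : EndJ) : minusAct α (c • T) = c • minusAct α T := by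
  simp only [minusAct, Matrix.smul_mulVec, L_smul, smul_sub, smul_comm c (2 : ℂ)]

/-- The component in `str(D_α)` of the bracket of `(u, T, x)` and `(v, S, y)`: one has
`[x, v] = 2 L_{xv} + 2 [L_x, L_v]` for `x ∈ D_α⁺`, `v ∈ D_α⁻`, and therefore, by
super skew-symmetry, `[u, y] = -2 L_{uy} + 2 [L_u, L_y]` for `u ∈ D_α⁻`, `y ∈ D_α⁺`. -/
def bracketZero (α : ℂ) (u : J) (T : EndJ) (x : J) (v : J) (S : EndJ) (y : J) : EndJ :=
  scomm T S
    + ((2 : ℂ) • L α (jmul α x v) + (2 : ℂ) • scomm (L α x) (L α v))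
    + (-(2 : ℂ) • L α (jmul α u y) + (2 : ℂ) • scomm (L α u) (L α y))

lemma bracketZero_mem (α : ℂ) (u : J) (T : str α) (x : J) (v : J) (S : str α) (y : J) :
    bracketZero α u T x v S y ∈ str α := by
  have hL := L_mem_str α
  exact add_mem (add_mem (scomm_mem_str T.2 S.2)
    (add_mem (Submodule.smul_mem _ _ (hL _)) (Submodule.smul_mem _ _ (scomm_mem_str (hL _) (hL _)))))
    (add_mem (Submodule.smul_mem _ _ (hL _)) (Submodule.smul_mem _ _ (scomm_mem_str (hL _) (hL _))))

/-- The bracket of `𝔤`. The terms with `flipAct` are `[u, S] = -(-1)^{|S||u|} [S, u]` and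
`[x, S] = -(-1)^{|S||x|} [S, x]`; moreover `[D_α⁺, D_α⁺] = 0 = [D_α⁻, D_α⁻]`. -/
def bracket (α : ℂ) (X Y : G α) : G α :=
  ((minusAct α X.2.1).mulVec Y.1 - flipAct (minusAct α Y.2.1) X.1,
    ⟨bracketZero α X.1 X.2.1 X.2.2 Y.1 Y.2.1 Y.2.2, bracketZero_mem α _ _ _ _ _ _⟩,
    (X.2.1 : EndJ).mulVec Y.2.2 - flipAct Y.2.1 X.2.2)

/-- Homogeneous elements of `𝔤`, of parity `0` (even) or `1` (odd). -/
def IsHomog {α : ℂ} (i : Fin 2) (X : G α) : Prop :=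
  if i = 0 then oddV X.1 = 0 ∧ oddM X.2.1 = 0 ∧ oddV X.2.2 = 0
  else oddV X.1 = X.1 ∧ oddM X.2.1 = X.2.1 ∧ oddV X.2.2 = X.2.2

/-- The operator `ad X`. -/
def ad (α : ℂ) (X : G α) : Module.End ℂ (G α) where
  toFun := bracket α X
  map_add' := by
    rintro ⟨v, S, y⟩ ⟨v', S', y'⟩
    refine Prod.ext ?_ (Prod.ext (Subtype.ext ?_) ?_)
    · simp only [bracket, Prod.mk_add_mk, Submodule.coe_add, minusAct_add, flipAct_add_left,
        Matrix.mulVec_add]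
      abel
    · simp only [bracket, bracketZero, Prod.mk_add_mk, Submodule.coe_add, jmul_add_right, L_add,
        scomm_add_right, smul_add]
      abel
    · simp only [bracket, Prod.mk_add_mk, Submodule.coe_add, flipAct_add_left, Matrix.mulVec_add]
      abel
  map_smul' := by
    rintro c ⟨v, S, y⟩
    refine Prod.ext ?_ (Prod.ext (Subtype.ext ?_) ?_)
    · simp only [bracket, Prod.smul_mk, Submodule.coe_smul, minusAct_smul, flipAct_smul_left,
        Matrix.mulVec_smul, smul_sub, RingHom.id_apply]
    · simp only [bracket, bracketZero, Prod.smul_mk, Submodule.coe_smul, jmul_smul_right, L_smul,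
        scomm_smul_right, smul_add, RingHom.id_apply, smul_comm c (2 : ℂ), smul_comm c (-2 : ℂ)]
    · simp only [bracket, Prod.smul_mk, Submodule.coe_smul, flipAct_smul_left,
        Matrix.mulVec_smul, smul_sub, RingHom.id_apply]

/-- The Cayley transform `c = exp((i/2) ad f) exp(i ad e)`, where `e` and `f` are the units of
`D_α⁺` and `D_α⁻`; both operators are nilpotent, with vanishing third power. -/
def cayley (α : ℂ) : Module.End ℂ (G α) :=
  IsNilpotent.exp ((Complex.I / 2) • ad α (jone, 0, 0)) *
    IsNilpotent.exp (Complex.I • ad α (0, 0, jone))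

/-! ### The universal enveloping algebra -/

/-- The defining relations `X Y = (-1)^{|X||Y|} Y X + [X, Y]` for homogeneous `X`, `Y`. -/
inductive UERel (α : ℂ) : TensorAlgebra ℂ (G α) → TensorAlgebra ℂ (G α) → Prop
  | comm (i j : Fin 2) (X Y : G α) (hX : IsHomog i X) (hY : IsHomog j Y) :
      UERel α (TensorAlgebra.ι ℂ X * TensorAlgebra.ι ℂ Y)
        ((-1 : ℂ) ^ ((i : ℕ) * (j : ℕ)) • (TensorAlgebra.ι ℂ Y * TensorAlgebra.ι ℂ X)
          + TensorAlgebra.ι ℂ (bracket α X Y))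

/-- The universal enveloping algebra `U(𝔤)`. -/
abbrev UE (α : ℂ) : Type := RingQuot (UERel α)

/-- The canonical map `𝔤 → U(𝔤)`. -/
def ueι (α : ℂ) : G α →ₗ[ℂ] UE α :=
  (RingQuot.mkAlgHom ℂ (UERel α)).toLinearMap ∘ₗ TensorAlgebra.ι ℂ

/-- `U_1(𝔤) = ℂ ⊕ 𝔤`, whose powers are the canonical filtration of `U(𝔤)`. -/
def ueOne (α : ℂ) : Submodule ℂ (UE α) := 1 ⊔ LinearMap.range (ueι α)

/-! ### Superpolynomials and the Bessel operators -/

/-- The superpolynomials `𝒫(ℂ^{2|2})` in two even and two odd variables. -/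
abbrev P : Type := MvPolynomial (Fin 2) ℂ ⊗[ℂ] ExteriorAlgebra ℂ (Fin 2 → ℂ)

/-- The coordinates: `z₁, z₂` (indices `0, 1`) are even and `z₃, z₄` (indices `2, 3`) are odd. -/
def z : Fin 4 → P :=
  ![MvPolynomial.X 0 ⊗ₜ 1, MvPolynomial.X 1 ⊗ₜ 1,
    1 ⊗ₜ ExteriorAlgebra.ι ℂ (Pi.single 0 1), 1 ⊗ₜ ExteriorAlgebra.ι ℂ (Pi.single 1 1)]

/-- Multiplication by the coordinate `zᵢ` from the left. -/
def Z (i : Fin 4) : Module.End ℂ P := LinearMap.mulLeft ℂ (z i)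

/-- The derivative with respect to an odd variable: the left odd derivation of the exterior algebra
which sends that variable to `1` and the other one to `0`. -/
def oddDeriv (i : Fin 2) : Module.End ℂ (ExteriorAlgebra ℂ (Fin 2 → ℂ)) :=
  CliffordAlgebra.contractLeft (Q := (0 : QuadraticForm ℂ (Fin 2 → ℂ)))
    (LinearMap.proj i : Module.Dual ℂ (Fin 2 → ℂ))

/-- The partial derivatives `∂/∂zᵢ`. -/
def pd : Fin 4 → Module.End ℂ P :=
  ![LinearMap.rTensor _ (MvPolynomial.pderiv (0 : Fin 2)).toLinearMap,
    LinearMap.rTensor _ (MvPolynomial.pderiv (1 : Fin 2)).toLinearMap,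
    LinearMap.lTensor _ (oddDeriv 0), LinearMap.lTensor _ (oddDeriv 1)]

/-- The Bessel operators `ℬ_λ(zᵢ)`, for `α ≠ 0`. -/
def bessel (α lam : ℂ) : Fin 4 → Module.End ℂ P :=
  ![(-lam • 1 + Z 0 * pd 0 + Z 2 * pd 2 + Z 3 * pd 3) * pd 0
      - (2 * α) • (Z 1 * pd 2 * pd 3),
    (-(lam / α) • 1 + Z 1 * pd 1 + Z 2 * pd 2 + Z 3 * pd 3) * pd 1
      - (2 : ℂ) • (Z 0 * pd 2 * pd 3),
    (-(2 * lam) • 1 + (2 : ℂ) • (Z 0 * pd 0) + (2 * α) • (Z 1 * pd 1)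
      + (2 * (1 + α)) • (Z 2 * pd 2)) * pd 3 + Z 2 * pd 0 * pd 1,
    ((2 * lam) • 1 - (2 : ℂ) • (Z 0 * pd 0) - (2 * α) • (Z 1 * pd 1)
      - (2 * (1 + α)) • (Z 3 * pd 3)) * pd 2 + Z 3 * pd 0 * pd 1]

/-! ### The Fock representation -/

/-- The character of `str(D_α)` with `2 L_{e₁} ↦ λ`, `2 L_{e₂} ↦ λ / α` that vanishes on
`L_ξ`, `L_η` and on all derivations. -/
def strChar (α lam : ℂ) (T : EndJ) : ℂ :=
  (T.mulVec jone 0 * lam + T.mulVec jone 1 * (lam / α)) / 2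

/-- The polynomial realisation `π_λ` of `𝔤` on `𝒫(ℂ^{2|2})`, for `α ≠ 0`. The basis
`f₁, f₂, ζ, θ` of `D_α⁻` corresponds to `z₁, z₂, z₃, z₄`: `u ∈ D_α⁻` acts as multiplication by
`-2 i u`, `T ∈ str(D_α)` as `λ(T) + ∑ⱼ [T, zⱼ] ∂ⱼ`, and `x ∈ D_α⁺` as `-(i/2) ℬ_λ(x)`. -/
def piRep (α lam : ℂ) (X : G α) : Module.End ℂ P :=
  (∑ i, (-2 * Complex.I * X.1 i) • Z i)
    + (strChar α lam X.2.1 • 1 + ∑ j, ∑ i, minusAct α X.2.1 i j • (Z i * pd j))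
    + ∑ i, (-(Complex.I / 2) * X.2.2 i) • bessel α lam i

/-- The Fock representation `ρ_λ = π_λ ∘ c`. -/
def rho (α lam : ℂ) (X : G α) : Module.End ℂ P := piRep α lam (cayley α X)

/-- Generators of `ℐ_λ`, for `λ = α` and for `λ = 1`; they span the space `V_λ`. -/
def idealGens (α lam : ℂ) : Set P :=
  if lam = α then {2 * z 0 * z 1 + z 2 * z 3, z 1 ^ 2, z 1 * z 2, z 1 * z 3}
  else {(2 * α) • (z 0 * z 1) + z 2 * z 3, z 0 ^ 2, z 0 * z 2, z 0 * z 3}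

/-- The ideal `ℐ_λ = 𝒫(ℂ^{2|2}) V_λ`, for `λ ∈ {1, α}`. -/
def fockIdeal (α lam : ℂ) : Submodule ℂ P :=
  (Ideal.span (idealGens α lam)).restrictScalars ℂ

/-- The polynomial Fock space `𝒫(ℂ^{2|2}) / ℐ_λ`. -/
abbrev Fock (α lam : ℂ) : Type := P ⧸ fockIdeal α lam

/-- `Φ` is the action of `U(𝔤)` on `𝒫(ℂ^{2|2}) / ℐ_λ` induced by the Fock representation. -/
def IsFockAction (α lam : ℂ) (Φ : UE α →ₐ[ℂ] Module.End ℂ (Fock α lam)) : Prop :=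
  ∀ (X : G α) (p : P),
    Φ (ueι α X) ((fockIdeal α lam).mkQ p) = (fockIdeal α lam).mkQ (rho α lam X p)

/-- The space `𝒫(ℂ^{2|2}) / ℐ_λ`, as a `U(𝔤)`-module through `Φ`. -/
def FockMod {α lam : ℂ} (_Φ : UE α →ₐ[ℂ] Module.End ℂ (Fock α lam)) : Type := Fock α lam

section FockMod

variable {α lam : ℂ} (Φ : UE α →ₐ[ℂ] Module.End ℂ (Fock α lam))

instance : AddCommGroup (FockMod Φ) := inferInstanceAs (AddCommGroup (Fock α lam))

instance : Module ℂ (FockMod Φ) := inferInstanceAs (Module ℂ (Fock α lam))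

instance : Module (UE α) (FockMod Φ) :=
  Module.compHom (Fock α lam) (Φ : UE α →+* Module.End ℂ (Fock α lam))

instance : IsScalarTower ℂ (UE α) (FockMod Φ) where
  smul_assoc c a m := by
    change Φ (c • a) m = c • Φ a m
    rw [map_smul]; rfl

/-- The class of the constant polynomial `1`. -/
def vac : FockMod Φ := (fockIdeal α lam).mkQ (1 : P)

/-- The `U(𝔤)`-module `F_λ = U(𝔤) 1 mod ℐ_λ`. -/
abbrev F : Submodule (UE α) (FockMod Φ) := Submodule.span (UE α) {vac Φ}

/-- The subspace `F_{λ,0} = ℂ 1` of `F_λ`. -/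
def FZero : Submodule ℂ (F Φ) :=
  Submodule.span ℂ {⟨vac Φ, Submodule.mem_span_singleton_self (vac Φ)⟩}

end FockMod

/-! ### The Gelfand–Kirillov dimension -/

/-- `limsup_{k → ∞} log_k dim (V^k F₀)`. -/
def gkGrowth {R M : Type*} [Ring R] [Algebra ℂ R] [AddCommGroup M] [Module ℂ M] [Module R M]
    [IsScalarTower ℂ R M] (V : Submodule ℂ R) (F₀ : Submodule ℂ M) : EReal :=
  Filter.limsup
    (fun k : ℕ => ((Real.logb k (Module.finrank ℂ (V ^ k • F₀ : Submodule ℂ M)) : ℝ) : EReal))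
    Filter.atTop

/-- `(V, F₀)` is admissible for the Gelfand–Kirillov dimension of the `R`-module `M`: `V` is a
finite-dimensional subspace of `R` that contains `1` and generates the algebra `R`, and `F₀` is a
finite-dimensional subspace of `M` that generates the module `M`. -/
structure IsGKPair {R M : Type*} [Ring R] [Algebra ℂ R] [AddCommGroup M] [Module ℂ M] [Module R M]
    [IsScalarTower ℂ R M] (V : Submodule ℂ R) (F₀ : Submodule ℂ M) : Prop where
  finite_left : FiniteDimensional ℂ V
  one_mem : (1 : R) ∈ V
  adjoin_eq_top : Algebra.adjoin ℂ (V : Set R) = ⊤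
  finite_right : FiniteDimensional ℂ F₀
  span_eq_top : Submodule.span R (F₀ : Set M) = ⊤

/-- The `R`-module `M` has Gelfand–Kirillov dimension `d`: it is a finitely generated module over a
finitely generated algebra and, for every admissible `(V, F₀)`, the growth exponent is `d`. -/
def HasGKDim (R M : Type*) [Ring R] [Algebra ℂ R] [AddCommGroup M] [Module ℂ M] [Module R M]
    [IsScalarTower ℂ R M] (d : EReal) : Prop :=
  (∃ (V : Submodule ℂ R) (F₀ : Submodule ℂ M), IsGKPair V F₀) ∧
    ∀ (V : Submodule ℂ R) (F₀ : Submodule ℂ M), IsGKPair V F₀ → gkGrowth V F₀ = d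

end D21

end

open scoped TensorProduct

noncomputable section

namespace D21

/-! The two cases are mirror images. Exchanging `e₁` and `e₂` and rescaling the odd part turns `D_α`
into `D_{1/α}`. Let `t` be the even variable whose square is not in the ideal and `s` the other one.
In both cases the character takes the value 1 on `2L` of the idempotent of `s`, and a value `ν` on
that of `t`, with `ν = α` or `ν = α⁻¹`. Modulo the ideal one has `s² = s z₃ = s z₄ = 0` and `z₃ z₄ =
κ t s`, with `κ = -2` or `κ = -2α`. Hence the quotient is the free `ℂ[t]`-module on `1, s, z₃, z₄`,
and an element is a quadruple of polynomials in one variable. There `𝔤` acts by explicit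
differential operators of order at most two, and the supercommutation relations are polynomial
identities in the entries of the Lie superalgebra elements (`modelRep_comm`). Three facts transport
this to the Fock space. The projection `modelProj` (first-order Taylor expansion in `s`) intertwines
`π_λ` with the model (`modelProj_piRep`, `modelProj_piRep_swap`). Its kernel is exactly the ideal
(`mem_span_modelGens_iff`). The Cayley transform is a parity-preserving automorphism of `𝔤`
(`cayley_bracket`, `cayley_homog`), being a product of exponentials of nilpotent even derivations.
So `ρ_λ` satisfies the defining relations of `U(𝔤)` on the quotient; uniqueness holds because `𝔤`
generates `U(𝔤)`. For the dimension, the Cayley transform is onto, so `ρ_λ(𝔤) = π_λ(𝔤)`. These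
operators raise the total degree by at most one, and `D_α⁻` acts by multiplication by all the
variables. Therefore `U_k(𝔤) F_{λ,0}` is the space of elements of total degree at most `k`
(`IsModel.map_emb`), of dimension `(k + 1) + 3k = 1 + 4k`. The growth exponent is at most 1 because
any other admissible pair is dominated by this filtration after a linear change of index. It is at
least 1 for every infinite-dimensional module, because `V^k M₀` grows strictly at every step. -/

open Polynomial in
/-- The free `ℂ[t]`-module with basis `1, s, z₃, z₄`. -/
abbrev FockModel : Type := Fin 4 → ℂ[X]

/-! ### Operators on the model and their supercommutators -/

section Model

open Polynomial

/-- The even part of the Fock action on the model: `u` acts by multiplication, `M` by a first order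
operator and `x` by Bessel operators. Only the even entries of `u`, `M`, `x` occur. -/
def evenOp (ν u0 u1 m00 m11 m22 m23 m32 x0 x1 : ℂ) : Module.End ℂ FockModel where
  toFun n :=
    -- Coordinates are taken along `1, s, z₃, z₄`. The scalar `-(ν m00 + m11) / 2` is the character,
    -- written through the action on `D_α⁻`. The Bessel operator of `s` only sends `s` to `-1`,
    -- whence the term `-x1 n 1`. The last diagonal entry of `M` is `m00 + m11 - m22`.
    ![C (u0) * X * n 0 + C (-(ν * m00 + m11) / 2) * n 0 + C (m00) * X * derivative (n 0)
        + C (x0) * (X * derivative (derivative (n 0)) - C ν * derivative (n 0)) - C (x1) * n 1,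
      C (u0) * X * n 1 + C (u1) * n 0 + C (-(ν * m00 + m11) / 2) * n 1
        + C (m00) * X * derivative (n 1) + C (m11) * n 1
        + C (x0) * (X * derivative (derivative (n 1)) - C ν * derivative (n 1)),
      C (u0) * X * n 2 + C (-(ν * m00 + m11) / 2) * n 2 + C (m00) * X * derivative (n 2)
        + C (m22) * n 2 + C (m23) * n 3
        + C (x0) * (X * derivative (derivative (n 2)) + C (1 - ν) * derivative (n 2)),
      C (u0) * X * n 3 + C (-(ν * m00 + m11) / 2) * n 3 + C (m00) * X * derivative (n 3)
        + C (m32) * n 2 + C (m00 + m11 - m22) * n 3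
        + C (x0) * (X * derivative (derivative (n 3)) + C (1 - ν) * derivative (n 3))]
  map_add' n n' := by ext1 i; fin_cases i <;> simp <;> ring
  map_smul' c n := by
    ext1 i
    fin_cases i <;> simp [smul_eq_C_mul] <;> ring

/-- The odd part of the Fock action on the model, where `z₃ z₄ = κ t s`. -/
def oddOp (ν κ u2 u3 m20 m21 m30 m31 x2 x3 : ℂ) : Module.End ℂ FockModel where
  toFun n :=
    -- The entries of `M` that send `z₃, z₄` to `t, s` are not parameters: the shape of the
    -- structure algebra makes them `κ` or `κν` times (up to sign) `m20, m21, m30, m31`. The other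
    -- factors `κ X` come from `z₃ z₄ = κ t s`.
    ![C (κ * m31) * X * n 2 - C (κ * m21) * X * n 3
        - C (κ * x2) * (X * derivative (n 3) - C ν * n 3)
        + C (κ * x3) * (X * derivative (n 2) - C ν * n 2),
      C (κ * u2) * X * n 3 - C (κ * u3) * X * n 2 + C (κ * ν * m30) * n 2
        - C (κ * ν * m20) * n 3
        - C (κ * m30) * X * derivative (n 2) + C (κ * m20) * X * derivative (n 3),
      C (u2) * n 0 + C (m20) * derivative (n 0) + C (m21) * n 1 + C (x2) * derivative (n 1),
      C (u3) * n 0 + C (m30) * derivative (n 0) + C (m31) * n 1 + C (x3) * derivative (n 1)]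
  map_add' n n' := by ext1 i; fin_cases i <;> simp <;> ring
  map_smul' c n := by
    ext1 i
    fin_cases i <;> simp [smul_eq_C_mul] <;> ring

theorem evenOp_comm (ν u0 u1 m00 m11 m22 m23 m32 x0 x1 v0 v1 k00 k11 k22 k23 k32 y0 y1 : ℂ) :
    evenOp ν u0 u1 m00 m11 m22 m23 m32 x0 x1 * evenOp ν v0 v1 k00 k11 k22 k23 k32 y0 y1
      - evenOp ν v0 v1 k00 k11 k22 k23 k32 y0 y1 * evenOp ν u0 u1 m00 m11 m22 m23 m32 x0 x1 =
      evenOp ν (m00 * v0 - k00 * u0) (m11 * v1 - k11 * u1)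
        (2 * (x0 * v0 - y0 * u0)) (2 * (x1 * v1 - y1 * u1))
        (m23 * k32 - k23 * m32 + (x0 * v0 - y0 * u0) + (x1 * v1 - y1 * u1))
        (m22 * k23 + m23 * (k00 + k11 - k22) - k22 * m23 - k23 * (m00 + m11 - m22))
        (m32 * k22 + (m00 + m11 - m22) * k32 - k32 * m22 - (k00 + k11 - k22) * m32)
        (k00 * x0 - m00 * y0) (k11 * x1 - m11 * y1) := by
  refine LinearMap.ext fun n => funext fun i => ?_
  -- The only denominator is the half in the character; it meets the factor 2 of the diagonal
  -- entries `2 * (x0 * v0 - y0 * u0)` and `2 * (x1 * v1 - y1 * u1)`.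
  have h2 : (C (2⁻¹ : ℂ)) * 2 = 1 := by
    rw [← C_ofNat, ← C_mul]; norm_num
  have hd : ∀ a : ℂ, a / 2 = a * 2⁻¹ := fun a => div_eq_mul_inv a 2
  fin_cases i
  all_goals
    simp only [evenOp, LinearMap.sub_apply, Module.End.mul_apply, LinearMap.coe_mk,
      AddHom.coe_mk, Pi.sub_apply, Fin.zero_eta, Fin.mk_one, Fin.reduceFinMk,
      Matrix.cons_val_zero, Matrix.cons_val_one, Matrix.cons_val]
    simp only [hd, C_add, C_mul, C_sub, C_neg, C_1, C_ofNat, derivative_add, derivative_sub,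
      derivative_neg, derivative_mul, derivative_C, derivative_X, derivative_zero, derivative_one,
      zero_mul, mul_zero, zero_add, add_zero, neg_zero, one_mul]
    generalize C (2⁻¹ : ℂ) = c at *
    generalize n 0 = n0
    generalize n 1 = n1
    generalize n 2 = n2
    generalize n 3 = n3
  · linear_combination (C ν * (C x0 * C v0 - C y0 * C u0) + (C x1 * C v1 - C y1 * C u1)) * n0 * h2
  · linear_combination (C ν * (C x0 * C v0 - C y0 * C u0) + (C x1 * C v1 - C y1 * C u1)) * n1 * h2
  · linear_combination (C ν * (C x0 * C v0 - C y0 * C u0) + (C x1 * C v1 - C y1 * C u1)) * n2 * h2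
  · linear_combination (C ν * (C x0 * C v0 - C y0 * C u0) + (C x1 * C v1 - C y1 * C u1)) * n3 * h2

theorem evenOp_oddOp_comm (ν κ u0 u1 m00 m11 m22 m23 m32 x0 x1 v2 v3 k20 k21 k30 k31 y2 y3 : ℂ) :
    evenOp ν u0 u1 m00 m11 m22 m23 m32 x0 x1 * oddOp ν κ v2 v3 k20 k21 k30 k31 y2 y3
      - oddOp ν κ v2 v3 k20 k21 k30 k31 y2 y3 * evenOp ν u0 u1 m00 m11 m22 m23 m32 x0 x1 =
      oddOp ν κ (m22 * v2 + m23 * v3 - k20 * u0 - k21 * u1)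
        (m32 * v2 + (m00 + m11 - m22) * v3 - k30 * u0 - k31 * u1)
        (m22 * k20 + m23 * k30 - k20 * m00 + x0 * v2 - u1 * y2)
        (m22 * k21 + m23 * k31 - k21 * m11 + x1 * v2 - u0 * y2)
        (m32 * k20 + (m00 + m11 - m22) * k30 - k30 * m00 + x0 * v3 - u1 * y3)
        (m32 * k21 + (m00 + m11 - m22) * k31 - k31 * m11 + x1 * v3 - u0 * y3)
        (-(m00 + m11 - m22) * y2 + m23 * y3 + k21 * x0 + k20 * x1)
        (m32 * y2 - m22 * y3 + k31 * x0 + k30 * x1) := by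
  refine LinearMap.ext fun n => funext fun i => ?_
  have hd : ∀ a : ℂ, a / 2 = a * 2⁻¹ := fun a => div_eq_mul_inv a 2
  fin_cases i
  all_goals
    simp only [evenOp, oddOp, LinearMap.sub_apply, Module.End.mul_apply, LinearMap.coe_mk,
      AddHom.coe_mk, Pi.sub_apply, Fin.zero_eta, Fin.mk_one, Fin.reduceFinMk,
      Matrix.cons_val_zero, Matrix.cons_val_one, Matrix.cons_val]
    simp only [hd, C_add, C_mul, C_sub, C_neg, C_1, derivative_add, derivative_sub,
      derivative_neg, derivative_mul, derivative_C, derivative_X, derivative_one,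
      zero_mul, mul_zero, zero_add, add_zero, neg_zero, one_mul]
    generalize C (2⁻¹ : ℂ) = c at *
    generalize n 0 = n0
    generalize n 1 = n1
    generalize n 2 = n2
    generalize n 3 = n3
    ring

theorem oddOp_comm (ν κ u2 u3 m20 m21 m30 m31 x2 x3 v2 v3 k20 k21 k30 k31 y2 y3 : ℂ) :
    oddOp ν κ u2 u3 m20 m21 m30 m31 x2 x3 * oddOp ν κ v2 v3 k20 k21 k30 k31 y2 y3
      + oddOp ν κ v2 v3 k20 k21 k30 k31 y2 y3 * oddOp ν κ u2 u3 m20 m21 m30 m31 x2 x3 =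
      evenOp ν (κ * (m31 * v2 - m21 * v3 + k31 * u2 - k21 * u3))
        (κ * ν * (m30 * v2 - m20 * v3 + k30 * u2 - k20 * u3))
        (κ * (m31 * k20 - m21 * k30 + k31 * m20 - k21 * m30
          - (x2 * v3 - x3 * v2) - (y2 * u3 - y3 * u2)))
        (κ * ν * (m30 * k21 - m20 * k31 + k30 * m21 - k20 * m31
          - (x2 * v3 - x3 * v2) - (y2 * u3 - y3 * u2)))
        (κ * (m20 * k31 + k20 * m31 + ν * (m21 * k30 + k21 * m30)
          - (1 + ν) * (x2 * v3 + y2 * u3)))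
        (-κ * (m20 * k21 + k20 * m21 + ν * (m21 * k20 + k21 * m20))
          + κ * (1 + ν) * (x2 * v2 + y2 * u2))
        (κ * (m30 * k31 + k30 * m31 + ν * (m31 * k30 + k31 * m30))
          - κ * (1 + ν) * (x3 * v3 + y3 * u3))
        (κ * (-m30 * y2 + m20 * y3 - k30 * x2 + k20 * x3))
        (κ * ν * (-m31 * y2 + m21 * y3 - k31 * x2 + k21 * x3)) := by
  refine LinearMap.ext fun n => funext fun i => ?_
  have h2 : (C (2⁻¹ : ℂ)) * 2 = 1 := by
    have : (2 : ℂ[X]) = C 2 := rfl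
    rw [this, ← C_mul]; norm_num
  have hd : ∀ a : ℂ, a / 2 = a * 2⁻¹ := fun a => div_eq_mul_inv a 2
  fin_cases i
  all_goals
    simp only [evenOp, oddOp, LinearMap.add_apply, Module.End.mul_apply, LinearMap.coe_mk,
      AddHom.coe_mk, Pi.add_apply, Fin.zero_eta, Fin.mk_one, Fin.reduceFinMk,
      Matrix.cons_val_zero, Matrix.cons_val_one, Matrix.cons_val]
    simp only [hd, C_add, C_mul, C_sub, C_neg, C_1, derivative_add, derivative_sub,
      derivative_mul, derivative_C, derivative_X,
      zero_mul, mul_zero, zero_add, add_zero, one_mul]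
    generalize C (2⁻¹ : ℂ) = c at *
    generalize n 0 = n0
    generalize n 1 = n1
    generalize n 2 = n2
    generalize n 3 = n3
  · linear_combination (-(C κ * C ν * ((C x2 * C v3 - C x3 * C v2)
      + (C y2 * C u3 - C y3 * C u2)))) * n0 * h2
  · linear_combination (-(C κ * C ν * ((C x2 * C v3 - C x3 * C v2)
      + (C y2 * C u3 - C y3 * C u2)))) * n1 * h2
  · linear_combination (-(C κ * C ν * ((C x2 * C v3 - C x3 * C v2)
      + (C y2 * C u3 - C y3 * C u2)))) * n2 * h2
  · linear_combination (-(C κ * C ν * ((C x2 * C v3 - C x3 * C v2)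
      + (C y2 * C u3 - C y3 * C u2)))) * n3 * h2

end Model

/-! ### The model is a representation of the Lie superalgebra -/

section Bracket

open Complex

/-- The action of `𝔤` on the model; `t` and `s` are the indices of the two even coordinates. -/
def modelRep (ν κ : ℂ) (t s : Fin 4) {α : ℂ} (X : G α) : Module.End ℂ FockModel :=
  evenOp ν (-2 * I * X.1 t) (-2 * I * X.1 s) (minusAct α X.2.1 t t) (minusAct α X.2.1 s s)
      (minusAct α X.2.1 2 2) (minusAct α X.2.1 2 3) (minusAct α X.2.1 3 2)
      (-(I / 2) * X.2.2 t) (-(I / 2) * X.2.2 s)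
    + oddOp ν κ (-2 * I * X.1 2) (-2 * I * X.1 3) (minusAct α X.2.1 2 t) (minusAct α X.2.1 2 s)
      (minusAct α X.2.1 3 t) (minusAct α X.2.1 3 s) (-(I / 2) * X.2.2 2) (-(I / 2) * X.2.2 3)

/-- The matrix of the action on `D_α⁻` of an element of the structure algebra. -/
theorem minusAct_eq {α : ℂ} {T : EndJ} (hT : StrShape α T) :
    minusAct α T =
      !![-T 0 0, 0, 2 * T 3 0, -2 * T 2 0;
        0, -T 1 1, 2 * α * T 3 1, -2 * α * T 2 1;
        -T 2 1, -T 2 0, -T 3 3, T 2 3;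
        -T 3 1, -T 3 0, T 3 2, -T 2 2] := by
  obtain ⟨h1, h2, h3, h4, h5, h6, h7⟩ := hT
  ext i j
  fin_cases i <;> fin_cases j <;>
  simp [minusAct, L, jmul, Matrix.mulVec, dotProduct, Fin.sum_univ_four, jone, h1, h2, h3, h4, h5,
      h6] <;> grind

theorem IsHomog.even_entries {α : ℂ} {X : G α} (h : IsHomog 0 X) :
    X.1 2 = 0 ∧ X.1 3 = 0 ∧ X.2.2 2 = 0 ∧ X.2.2 3 = 0 ∧
      (X.2.1 : EndJ) 2 0 = 0 ∧ (X.2.1 : EndJ) 2 1 = 0 ∧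
      (X.2.1 : EndJ) 3 0 = 0 ∧ (X.2.1 : EndJ) 3 1 = 0 := by
  obtain ⟨h1, h2, h3⟩ := h
  obtain ⟨o0, o1, o2, o3⟩ := odd_table
  refine ⟨?_, ?_, ?_, ?_, ?_, ?_, ?_, ?_⟩
  · simpa [oddV, o2] using congrFun h1 2
  · simpa [oddV, o3] using congrFun h1 3
  · simpa [oddV, o2] using congrFun h3 2
  · simpa [oddV, o3] using congrFun h3 3
  · simpa [oddM, o0, o2] using congrFun₂ h2 2 0
  · simpa [oddM, o1, o2] using congrFun₂ h2 2 1
  · simpa [oddM, o0, o3] using congrFun₂ h2 3 0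
  · simpa [oddM, o1, o3] using congrFun₂ h2 3 1

theorem IsHomog.odd_entries {α : ℂ} {X : G α} (h : IsHomog 1 X) :
    X.1 0 = 0 ∧ X.1 1 = 0 ∧ X.2.2 0 = 0 ∧ X.2.2 1 = 0 ∧
      (X.2.1 : EndJ) 0 0 = 0 ∧ (X.2.1 : EndJ) 1 1 = 0 ∧ (X.2.1 : EndJ) 2 2 = 0 ∧
      (X.2.1 : EndJ) 2 3 = 0 ∧ (X.2.1 : EndJ) 3 2 = 0 ∧ (X.2.1 : EndJ) 3 3 = 0 := by
  obtain ⟨h1, h2, h3⟩ := h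
  obtain ⟨o0, o1, o2, o3⟩ := odd_table
  refine ⟨?_, ?_, ?_, ?_, ?_, ?_, ?_, ?_, ?_, ?_⟩
  · simpa [oddV, o0] using (congrFun h1 0).symm
  · simpa [oddV, o1] using (congrFun h1 1).symm
  · simpa [oddV, o0] using (congrFun h3 0).symm
  · simpa [oddV, o1] using (congrFun h3 1).symm
  · simpa [oddM, o0] using (congrFun₂ h2 0 0).symm
  · simpa [oddM, o1] using (congrFun₂ h2 1 1).symm
  · simpa [oddM, o2] using (congrFun₂ h2 2 2).symm
  · simpa [oddM, o2, o3] using (congrFun₂ h2 2 3).symm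
  · simpa [oddM, o2, o3] using (congrFun₂ h2 3 2).symm
  · simpa [oddM, o3] using (congrFun₂ h2 3 3).symm

theorem evenOp_zero (ν : ℂ) : evenOp ν 0 0 0 0 0 0 0 0 0 = 0 := by
  refine LinearMap.ext fun n => funext fun i => ?_
  fin_cases i <;> simp [evenOp]

theorem oddOp_zero (ν κ : ℂ) : oddOp ν κ 0 0 0 0 0 0 0 0 = 0 := by
  refine LinearMap.ext fun n => funext fun i => ?_
  fin_cases i <;> simp [oddOp]

theorem bracket_fst {α : ℂ} (X Y : G α) :
    (bracket α X Y).1 = (minusAct α X.2.1).mulVec Y.1 - flipAct (minusAct α Y.2.1) X.1 := rfl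

theorem bracket_snd_fst {α : ℂ} (X Y : G α) :
    ((bracket α X Y).2.1 : EndJ) = bracketZero α X.1 X.2.1 X.2.2 Y.1 Y.2.1 Y.2.2 := rfl

theorem bracket_snd_snd {α : ℂ} (X Y : G α) :
    (bracket α X Y).2.2 = (X.2.1 : EndJ).mulVec Y.2.2 - flipAct Y.2.1 X.2.2 := rfl

theorem flipAct_apply (S : EndJ) (x : J) (i : Fin 4) :
    flipAct S x i = ∑ j, (S i j * x j - 2 * ((if isOdd i ↔ isOdd j then 0 else S i j) *
      if isOdd j then x j else 0)) := by
  simp [flipAct, oddM, oddV, Matrix.mulVec, dotProduct, Finset.sum_sub_distrib, Finset.mul_sum]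

theorem oddOp_neg (ν κ u2 u3 m20 m21 m30 m31 x2 x3 : ℂ) :
    -oddOp ν κ u2 u3 m20 m21 m30 m31 x2 x3
      = oddOp ν κ (-u2) (-u3) (-m20) (-m21) (-m30) (-m31) (-x2) (-x3) := by
  refine LinearMap.ext fun n => funext fun i => ?_
  fin_cases i
  all_goals
    simp only [oddOp, LinearMap.neg_apply, LinearMap.coe_mk, AddHom.coe_mk, Pi.neg_apply,
        Fin.zero_eta,
      Fin.mk_one, Fin.reduceFinMk, Matrix.cons_val_zero, Matrix.cons_val_one, Matrix.cons_val]
    simp only [Polynomial.C_mul, Polynomial.C_neg]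
    generalize n 0 = n0
    generalize n 1 = n1
    generalize n 2 = n2
    generalize n 3 = n3
    ring

theorem modelRep_even_even {α ν κ : ℂ} {X Y : G α} (hX : IsHomog 0 X)
    (hY : IsHomog 0 Y) :
    modelRep ν κ 0 1 X * modelRep ν κ 0 1 Y
      - modelRep ν κ 0 1 Y * modelRep ν κ 0 1 X = modelRep ν κ 0 1 (bracket α X Y) := by
  obtain ⟨o0, o1, o2, o3⟩ := odd_table
  obtain ⟨a1, a2, a3, a4, a5, a6, a7, a8⟩ := hX.even_entries
  obtain ⟨b1, b2, b3, b4, b5, b6, b7, b8⟩ := hY.even_entries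
  have hT := mem_str_iff.1 X.2.1.2
  have hS := mem_str_iff.1 Y.2.1.2
  have hB := mem_str_iff.1 (bracket α X Y).2.1.2
  have hI := I_mul_I
  simp only [modelRep, minusAct_eq hT, minusAct_eq hS, minusAct_eq hB]
  obtain ⟨c1, c2, c3, c4, c5, c6, c7⟩ := hT
  obtain ⟨d1, d2, d3, d4, d5, d6, d7⟩ := hS
  simp [bracket_fst, bracket_snd_fst, bracket_snd_snd, bracketZero,
    minusAct_eq (mem_str_iff.1 X.2.1.2), minusAct_eq (mem_str_iff.1 Y.2.1.2), scomm_apply,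
    flipAct_apply, Matrix.mulVec, dotProduct, L, jmul, Fin.sum_univ_four, o0, o1, o2, o3,
    a1, a2, a3, a4, a5, a6, a7, a8, b1, b2, b3, b4, b5, b6, b7, b8,
    c1, c2, c3, c4, c5, c6, d1, d2, d3, d4, d5, d6, oddOp_zero, evenOp_comm]
  -- Both sides are now a single `evenOp`, so only its parameters are compared. `hI` turns the
  -- product of the factors `-2i` of `D_α⁻` and `-i/2` of `D_α⁺` into `-1`.
  congr 1 <;> grind

theorem modelRep_even_odd {α ν κ : ℂ} {X Y : G α} (hX : IsHomog 0 X)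
    (hY : IsHomog 1 Y) :
    modelRep ν κ 0 1 X * modelRep ν κ 0 1 Y
      - modelRep ν κ 0 1 Y * modelRep ν κ 0 1 X = modelRep ν κ 0 1 (bracket α X Y) := by
  obtain ⟨o0, o1, o2, o3⟩ := odd_table
  obtain ⟨a1, a2, a3, a4, a5, a6, a7, a8⟩ := hX.even_entries
  obtain ⟨b1, b2, b3, b4, b5, b6, b7, b8, b9, b10⟩ := hY.odd_entries
  have hT := mem_str_iff.1 X.2.1.2
  have hS := mem_str_iff.1 Y.2.1.2
  have hB := mem_str_iff.1 (bracket α X Y).2.1.2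
  have hI := I_mul_I
  simp only [modelRep, minusAct_eq hT, minusAct_eq hS, minusAct_eq hB]
  obtain ⟨c1, c2, c3, c4, c5, c6, c7⟩ := hT
  obtain ⟨d1, d2, d3, d4, d5, d6, d7⟩ := hS
  simp [bracket_fst, bracket_snd_fst, bracket_snd_snd, bracketZero,
    minusAct_eq (mem_str_iff.1 X.2.1.2), minusAct_eq (mem_str_iff.1 Y.2.1.2), scomm_apply,
    flipAct_apply, Matrix.mulVec, dotProduct, L, jmul, Fin.sum_univ_four, o0, o1, o2, o3,
    a1, a2, a3, a4, a5, a6, a7, a8, b1, b2, b3, b4, b5, b6, b7, b8, b9, b10,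
    c1, c2, c3, c4, c5, c6, d1, d2, d3, d4, d5, d6, oddOp_zero, evenOp_zero, evenOp_oddOp_comm]
  congr 1 <;> grind

theorem modelRep_odd_even {α ν κ : ℂ} {X Y : G α} (hX : IsHomog 1 X)
    (hY : IsHomog 0 Y) :
    modelRep ν κ 0 1 X * modelRep ν κ 0 1 Y
      - modelRep ν κ 0 1 Y * modelRep ν κ 0 1 X = modelRep ν κ 0 1 (bracket α X Y) := by
  obtain ⟨o0, o1, o2, o3⟩ := odd_table
  obtain ⟨a1, a2, a3, a4, a5, a6, a7, a8, a9, a10⟩ := hX.odd_entries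
  obtain ⟨b1, b2, b3, b4, b5, b6, b7, b8⟩ := hY.even_entries
  have hT := mem_str_iff.1 X.2.1.2
  have hS := mem_str_iff.1 Y.2.1.2
  have hB := mem_str_iff.1 (bracket α X Y).2.1.2
  have hI := I_mul_I
  -- Negating puts the even element first, so that `evenOp_oddOp_comm` applies.
  rw [← neg_inj, neg_sub]
  simp only [modelRep, minusAct_eq hT, minusAct_eq hS, minusAct_eq hB]
  obtain ⟨c1, c2, c3, c4, c5, c6, c7⟩ := hT
  obtain ⟨d1, d2, d3, d4, d5, d6, d7⟩ := hS
  simp [bracket_fst, bracket_snd_fst, bracket_snd_snd, bracketZero,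
    minusAct_eq (mem_str_iff.1 X.2.1.2), minusAct_eq (mem_str_iff.1 Y.2.1.2), scomm_apply,
    flipAct_apply, Matrix.mulVec, dotProduct, L, jmul, Fin.sum_univ_four, o0, o1, o2, o3,
    a1, a2, a3, a4, a5, a6, a7, a8, a9, a10, b1, b2, b3, b4, b5, b6, b7, b8,
    c1, c2, c3, c4, c5, c6, d1, d2, d3, d4, d5, d6, oddOp_zero, evenOp_zero,
    evenOp_oddOp_comm, oddOp_neg]
  congr 1 <;> grind

/-- This case ties the parameters of the model to `α`, through the product `ξη = e₁ + α e₂`. The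
even and the mixed relations hold for all `ν` and `κ`. -/
theorem modelRep_odd_odd {α ν κ : ℂ} (hν : ν = α) (hκ : κ = -2) {X Y : G α} (hX : IsHomog 1 X)
    (hY : IsHomog 1 Y) :
    modelRep ν κ 0 1 X * modelRep ν κ 0 1 Y
      + modelRep ν κ 0 1 Y * modelRep ν κ 0 1 X = modelRep ν κ 0 1 (bracket α X Y) := by
  obtain ⟨o0, o1, o2, o3⟩ := odd_table
  obtain ⟨a1, a2, a3, a4, a5, a6, a7, a8, a9, a10⟩ := hX.odd_entries
  obtain ⟨b1, b2, b3, b4, b5, b6, b7, b8, b9, b10⟩ := hY.odd_entries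
  have hT := mem_str_iff.1 X.2.1.2
  have hS := mem_str_iff.1 Y.2.1.2
  have hB := mem_str_iff.1 (bracket α X Y).2.1.2
  have hI := I_mul_I
  simp only [modelRep, minusAct_eq hT, minusAct_eq hS, minusAct_eq hB]
  obtain ⟨c1, c2, c3, c4, c5, c6, c7⟩ := hT
  obtain ⟨d1, d2, d3, d4, d5, d6, d7⟩ := hS
  simp [bracket_fst, bracket_snd_fst, bracket_snd_snd, bracketZero,
    minusAct_eq (mem_str_iff.1 X.2.1.2), minusAct_eq (mem_str_iff.1 Y.2.1.2), scomm_apply,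
    flipAct_apply, Matrix.mulVec, dotProduct, L, jmul, Fin.sum_univ_four, o0, o1, o2, o3,
    a1, a2, a3, a4, a5, a6, a7, a8, a9, a10, b1, b2, b3, b4, b5, b6, b7, b8, b9, b10,
    c1, c2, c3, c4, c5, c6, d1, d2, d3, d4, d5, d6, oddOp_zero, evenOp_zero, oddOp_comm]
  congr 1 <;> grind

/-- From here on `t` is the second even coordinate. The odd basis is not rescaled when the
idempotents are exchanged, so a factor `α` stays in `κ = -2α` when two odd elements are bracketed.
-/
theorem modelRep_even_even_swap {α ν κ : ℂ} {X Y : G α} (hX : IsHomog 0 X)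
    (hY : IsHomog 0 Y) :
    modelRep ν κ 1 0 X * modelRep ν κ 1 0 Y
      - modelRep ν κ 1 0 Y * modelRep ν κ 1 0 X = modelRep ν κ 1 0 (bracket α X Y) := by
  obtain ⟨o0, o1, o2, o3⟩ := odd_table
  obtain ⟨a1, a2, a3, a4, a5, a6, a7, a8⟩ := hX.even_entries
  obtain ⟨b1, b2, b3, b4, b5, b6, b7, b8⟩ := hY.even_entries
  have hT := mem_str_iff.1 X.2.1.2
  have hS := mem_str_iff.1 Y.2.1.2
  have hB := mem_str_iff.1 (bracket α X Y).2.1.2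
  have hI := I_mul_I
  simp only [modelRep, minusAct_eq hT, minusAct_eq hS, minusAct_eq hB]
  obtain ⟨c1, c2, c3, c4, c5, c6, c7⟩ := hT
  obtain ⟨d1, d2, d3, d4, d5, d6, d7⟩ := hS
  simp [bracket_fst, bracket_snd_fst, bracket_snd_snd, bracketZero,
    minusAct_eq (mem_str_iff.1 X.2.1.2), minusAct_eq (mem_str_iff.1 Y.2.1.2), scomm_apply,
    flipAct_apply, Matrix.mulVec, dotProduct, L, jmul, Fin.sum_univ_four, o0, o1, o2, o3,
    a1, a2, a3, a4, a5, a6, a7, a8, b1, b2, b3, b4, b5, b6, b7, b8,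
    c1, c2, c3, c4, c5, c6, d1, d2, d3, d4, d5, d6, oddOp_zero, evenOp_comm]
  congr 1 <;> grind

theorem modelRep_even_odd_swap {α ν κ : ℂ} {X Y : G α} (hX : IsHomog 0 X)
    (hY : IsHomog 1 Y) :
    modelRep ν κ 1 0 X * modelRep ν κ 1 0 Y
      - modelRep ν κ 1 0 Y * modelRep ν κ 1 0 X = modelRep ν κ 1 0 (bracket α X Y) := by
  obtain ⟨o0, o1, o2, o3⟩ := odd_table
  obtain ⟨a1, a2, a3, a4, a5, a6, a7, a8⟩ := hX.even_entries
  obtain ⟨b1, b2, b3, b4, b5, b6, b7, b8, b9, b10⟩ := hY.odd_entries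
  have hT := mem_str_iff.1 X.2.1.2
  have hS := mem_str_iff.1 Y.2.1.2
  have hB := mem_str_iff.1 (bracket α X Y).2.1.2
  have hI := I_mul_I
  simp only [modelRep, minusAct_eq hT, minusAct_eq hS, minusAct_eq hB]
  obtain ⟨c1, c2, c3, c4, c5, c6, c7⟩ := hT
  obtain ⟨d1, d2, d3, d4, d5, d6, d7⟩ := hS
  simp [bracket_fst, bracket_snd_fst, bracket_snd_snd, bracketZero,
    minusAct_eq (mem_str_iff.1 X.2.1.2), minusAct_eq (mem_str_iff.1 Y.2.1.2), scomm_apply,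
    flipAct_apply, Matrix.mulVec, dotProduct, L, jmul, Fin.sum_univ_four, o0, o1, o2, o3,
    a1, a2, a3, a4, a5, a6, a7, a8, b1, b2, b3, b4, b5, b6, b7, b8, b9, b10,
    c1, c2, c3, c4, c5, c6, d1, d2, d3, d4, d5, d6, oddOp_zero, evenOp_zero, evenOp_oddOp_comm]
  congr 1 <;> grind

theorem modelRep_odd_even_swap {α ν κ : ℂ} {X Y : G α} (hX : IsHomog 1 X)
    (hY : IsHomog 0 Y) :
    modelRep ν κ 1 0 X * modelRep ν κ 1 0 Y
      - modelRep ν κ 1 0 Y * modelRep ν κ 1 0 X = modelRep ν κ 1 0 (bracket α X Y) := by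
  obtain ⟨o0, o1, o2, o3⟩ := odd_table
  obtain ⟨a1, a2, a3, a4, a5, a6, a7, a8, a9, a10⟩ := hX.odd_entries
  obtain ⟨b1, b2, b3, b4, b5, b6, b7, b8⟩ := hY.even_entries
  have hT := mem_str_iff.1 X.2.1.2
  have hS := mem_str_iff.1 Y.2.1.2
  have hB := mem_str_iff.1 (bracket α X Y).2.1.2
  have hI := I_mul_I
  rw [← neg_inj, neg_sub]
  simp only [modelRep, minusAct_eq hT, minusAct_eq hS, minusAct_eq hB]
  obtain ⟨c1, c2, c3, c4, c5, c6, c7⟩ := hT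
  obtain ⟨d1, d2, d3, d4, d5, d6, d7⟩ := hS
  simp [bracket_fst, bracket_snd_fst, bracket_snd_snd, bracketZero,
    minusAct_eq (mem_str_iff.1 X.2.1.2), minusAct_eq (mem_str_iff.1 Y.2.1.2), scomm_apply,
    flipAct_apply, Matrix.mulVec, dotProduct, L, jmul, Fin.sum_univ_four, o0, o1, o2, o3,
    a1, a2, a3, a4, a5, a6, a7, a8, a9, a10, b1, b2, b3, b4, b5, b6, b7, b8,
    c1, c2, c3, c4, c5, c6, d1, d2, d3, d4, d5, d6, oddOp_zero, evenOp_zero,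
    evenOp_oddOp_comm, oddOp_neg]
  congr 1 <;> grind

theorem modelRep_odd_odd_swap {α ν κ : ℂ} (hα : α ≠ 0) (hν : ν = α⁻¹)
    (hκ : κ = -2 * α) {X Y : G α} (hX : IsHomog 1 X)
    (hY : IsHomog 1 Y) :
    modelRep ν κ 1 0 X * modelRep ν κ 1 0 Y
      + modelRep ν κ 1 0 Y * modelRep ν κ 1 0 X = modelRep ν κ 1 0 (bracket α X Y) := by
  obtain ⟨o0, o1, o2, o3⟩ := odd_table
  obtain ⟨a1, a2, a3, a4, a5, a6, a7, a8, a9, a10⟩ := hX.odd_entries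
  obtain ⟨b1, b2, b3, b4, b5, b6, b7, b8, b9, b10⟩ := hY.odd_entries
  have hT := mem_str_iff.1 X.2.1.2
  have hS := mem_str_iff.1 Y.2.1.2
  have hB := mem_str_iff.1 (bracket α X Y).2.1.2
  have hI := I_mul_I
  simp only [modelRep, minusAct_eq hT, minusAct_eq hS, minusAct_eq hB]
  obtain ⟨c1, c2, c3, c4, c5, c6, c7⟩ := hT
  obtain ⟨d1, d2, d3, d4, d5, d6, d7⟩ := hS
  simp [bracket_fst, bracket_snd_fst, bracket_snd_snd, bracketZero,
    minusAct_eq (mem_str_iff.1 X.2.1.2), minusAct_eq (mem_str_iff.1 Y.2.1.2), scomm_apply,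
    flipAct_apply, Matrix.mulVec, dotProduct, L, jmul, Fin.sum_univ_four, o0, o1, o2, o3,
    a1, a2, a3, a4, a5, a6, a7, a8, a9, a10, b1, b2, b3, b4, b5, b6, b7, b8, b9, b10,
    c1, c2, c3, c4, c5, c6, d1, d2, d3, d4, d5, d6, oddOp_zero, evenOp_zero, oddOp_comm]
  congr 1 <;> grind

/-- The parameters of the model: `λ = α` with `t = z₁`, and `λ = 1` with `t = z₂`. -/
def ModelParams (α ν κ : ℂ) (t s : Fin 4) : Prop :=
  (ν = α ∧ κ = -2 ∧ t = 0 ∧ s = 1) ∨ (α ≠ 0 ∧ ν = α⁻¹ ∧ κ = -2 * α ∧ t = 1 ∧ s = 0)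

theorem modelRep_comm {α ν κ : ℂ} {t s : Fin 4} (h : ModelParams α ν κ t s) {i j : Fin 2}
    {X Y : G α} (hX : IsHomog i X) (hY : IsHomog j Y) :
    modelRep ν κ t s X * modelRep ν κ t s Y =
      (-1 : ℂ) ^ ((i : ℕ) * (j : ℕ)) • (modelRep ν κ t s Y * modelRep ν κ t s X)
        + modelRep ν κ t s (bracket α X Y) := by
  rcases h with ⟨h1, h2, rfl, rfl⟩ | ⟨h0, h1, h2, rfl, rfl⟩ <;>
  fin_cases i <;> fin_cases j
  · simp [← modelRep_even_even hX hY]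
  · simp [← modelRep_even_odd hX hY]
  · simp [← modelRep_odd_even hX hY]
  · rw [← modelRep_odd_odd h1 h2 hX hY]
    simp only [mul_one, pow_one]
    module
  · simp [← modelRep_even_even_swap hX hY]
  · simp [← modelRep_even_odd_swap hX hY]
  · simp [← modelRep_odd_even_swap hX hY]
  · rw [← modelRep_odd_odd_swap h0 h1 h2 hX hY]
    simp only [mul_one, pow_one]
    module

theorem evenOp_add (ν u0 u1 m00 m11 m22 m23 m32 x0 x1 v0 v1 k00 k11 k22 k23 k32 y0 y1 : ℂ) :
    evenOp ν (u0 + v0) (u1 + v1) (m00 + k00) (m11 + k11) (m22 + k22) (m23 + k23) (m32 + k32)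
      (x0 + y0) (x1 + y1) = 
    evenOp ν u0 u1 m00 m11 m22 m23 m32 x0 x1 + evenOp ν v0 v1 k00 k11 k22 k23 k32 y0 y1 := by
  refine LinearMap.ext fun n => funext fun i => ?_
  fin_cases i
  all_goals
    simp only [evenOp, LinearMap.add_apply, LinearMap.coe_mk, AddHom.coe_mk, Pi.add_apply,
        Fin.zero_eta,
      Fin.mk_one, Fin.reduceFinMk, Matrix.cons_val_zero, Matrix.cons_val_one, Matrix.cons_val]
    simp only [div_eq_mul_inv, Polynomial.C_add, Polynomial.C_mul, Polynomial.C_sub,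
      Polynomial.C_neg, Polynomial.C_1]
    generalize n 0 = n0
    generalize n 1 = n1
    generalize n 2 = n2
    generalize n 3 = n3
    ring

theorem oddOp_add (ν κ u2 u3 m20 m21 m30 m31 x2 x3 v2 v3 k20 k21 k30 k31 y2 y3 : ℂ) :
    oddOp ν κ (u2 + v2) (u3 + v3) (m20 + k20) (m21 + k21) (m30 + k30) (m31 + k31)
      (x2 + y2) (x3 + y3) =
    oddOp ν κ u2 u3 m20 m21 m30 m31 x2 x3 + oddOp ν κ v2 v3 k20 k21 k30 k31 y2 y3 := by
  refine LinearMap.ext fun n => funext fun i => ?_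
  fin_cases i
  all_goals
    simp only [oddOp, LinearMap.add_apply, LinearMap.coe_mk, AddHom.coe_mk, Pi.add_apply,
        Fin.zero_eta,
      Fin.mk_one, Fin.reduceFinMk, Matrix.cons_val_zero, Matrix.cons_val_one, Matrix.cons_val]
    simp only [Polynomial.C_add, Polynomial.C_mul]
    generalize n 0 = n0
    generalize n 1 = n1
    generalize n 2 = n2
    generalize n 3 = n3
    ring

theorem evenOp_smul (ν c u0 u1 m00 m11 m22 m23 m32 x0 x1 : ℂ) :
    evenOp ν (c * u0) (c * u1) (c * m00) (c * m11) (c * m22) (c * m23) (c * m32) (c * x0) (c * x1)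
      = c • evenOp ν u0 u1 m00 m11 m22 m23 m32 x0 x1 := by
  refine LinearMap.ext fun n => funext fun i => ?_
  fin_cases i
  all_goals
    simp only [evenOp, LinearMap.smul_apply,
      LinearMap.coe_mk, AddHom.coe_mk, Pi.smul_apply, Fin.zero_eta,
      Fin.mk_one, Fin.reduceFinMk, Matrix.cons_val_zero, Matrix.cons_val_one, Matrix.cons_val,
      Polynomial.smul_eq_C_mul]
    simp only [div_eq_mul_inv, Polynomial.C_add, Polynomial.C_mul, Polynomial.C_sub,
      Polynomial.C_neg, Polynomial.C_1]
    generalize n 0 = n0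
    generalize n 1 = n1
    generalize n 2 = n2
    generalize n 3 = n3
    ring

theorem oddOp_smul (ν κ c u2 u3 m20 m21 m30 m31 x2 x3 : ℂ) :
    oddOp ν κ (c * u2) (c * u3) (c * m20) (c * m21) (c * m30) (c * m31) (c * x2) (c * x3) =
    c • oddOp ν κ u2 u3 m20 m21 m30 m31 x2 x3 := by
  refine LinearMap.ext fun n => funext fun i => ?_
  fin_cases i
  all_goals
    simp only [oddOp, LinearMap.smul_apply,
      LinearMap.coe_mk, AddHom.coe_mk, Pi.smul_apply, Fin.zero_eta,
      Fin.mk_one, Fin.reduceFinMk, Matrix.cons_val_zero, Matrix.cons_val_one, Matrix.cons_val,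
      Polynomial.smul_eq_C_mul]
    simp only [Polynomial.C_mul]
    generalize n 0 = n0
    generalize n 1 = n1
    generalize n 2 = n2
    generalize n 3 = n3
    ring

/-- `modelRep` as a linear map. -/
def modelRepₗ (ν κ : ℂ) (t s : Fin 4) (α : ℂ) : G α →ₗ[ℂ] Module.End ℂ FockModel where
  toFun := modelRep ν κ t s
  map_add' X Y := by
    simp only [modelRep, Prod.fst_add, Prod.snd_add, Pi.add_apply, Submodule.coe_add,
      minusAct_add, Matrix.add_apply, mul_add, evenOp_add, oddOp_add]
    abel
  map_smul' c X := by
    simp only [modelRep, Prod.smul_fst, Prod.smul_snd, Pi.smul_apply, Submodule.coe_smul,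
      minusAct_smul, Matrix.smul_apply, smul_eq_mul, mul_left_comm _ c, evenOp_smul, oddOp_smul,
      smul_add, RingHom.id_apply]

end Bracket

/-! ### The adjoint actions of the two units are derivations -/

section Cayley

/-- Seven linear relations on sixteen entries leave nine free ones, so the structure algebra has
dimension nine and identities in it need only nine checks. -/
theorem StrShape.ext {α : ℂ} {T S : EndJ} (hT : StrShape α T) (hS : StrShape α S)
    (h00 : T 0 0 = S 0 0) (h11 : T 1 1 = S 1 1) (h22 : T 2 2 = S 2 2) (h23 : T 2 3 = S 2 3)
    (h32 : T 3 2 = S 3 2) (h20 : T 2 0 = S 2 0) (h21 : T 2 1 = S 2 1) (h30 : T 3 0 = S 3 0)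
    (h31 : T 3 1 = S 3 1) : T = S := by
  obtain ⟨c1, c2, c3, c4, c5, c6, c7⟩ := hT
  obtain ⟨d1, d2, d3, d4, d5, d6, d7⟩ := hS
  ext i j
  fin_cases i <;> fin_cases j <;> simp <;> grind

theorem G.ext {α : ℂ} {X Y : G α} (h1 : X.1 = Y.1) (h2 : (X.2.1 : EndJ) = Y.2.1)
    (h3 : X.2.2 = Y.2.2) : X = Y :=
  Prod.ext h1 (Prod.ext (Subtype.ext h2) h3)

theorem ad_apply (α : ℂ) (X Y : G α) : ad α X Y = bracket α X Y := rfl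

theorem jmul_one_left (α : ℂ) (x : J) : jmul α jone x = x := by
  ext i; fin_cases i <;> simp [jmul, jone] <;> ring

theorem L_one (α : ℂ) : L α jone = 1 := by
  ext i j
  simp [L, jmul_one_left, Matrix.one_apply, Pi.single_apply]

theorem oddM_one : oddM 1 = 0 := by
  ext i j; fin_cases i <;> fin_cases j <;> simp [oddM, Matrix.one_apply, isOdd]

theorem oddV_one : oddV jone = 0 := by
  ext i; fin_cases i <;> simp [oddV, jone, isOdd]

theorem scomm_one_left (T : EndJ) : scomm 1 T = 0 := by simp [scomm, oddM_one]

theorem flipAct_one (S : EndJ) : flipAct S jone = S.mulVec jone := by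
  simp [flipAct, oddV_one]

theorem minusAct_mulVec_one (α : ℂ) (T : EndJ) :
    (minusAct α T).mulVec jone = -T.mulVec jone := by
  rw [minusAct, Matrix.sub_mulVec, Matrix.smul_mulVec, L_mulVec_one]; module

theorem L_zero (α : ℂ) : L α 0 = 0 := by
  simpa using L_smul α 0 0

theorem minusAct_zero (α : ℂ) : minusAct α 0 = 0 := by simp [minusAct, L_zero]

theorem oddM_zero : oddM 0 = 0 := by simpa using oddM_smul 0 0

theorem oddV_zero : oddV 0 = 0 := by simpa using oddV_smul 0 0

theorem jmul_zero_left (α : ℂ) (x : J) : jmul α 0 x = 0 := by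
  simpa using jmul_smul_left α 0 0 x

theorem jmul_zero_right (α : ℂ) (x : J) : jmul α x 0 = 0 := by
  simpa using jmul_smul_right α 0 x 0

theorem scomm_zero_left (T : EndJ) : scomm 0 T = 0 := by simpa using scomm_smul_left 0 0 T

theorem scomm_zero_right (T : EndJ) : scomm T 0 = 0 := by simpa using scomm_smul_right 0 T 0

theorem flipAct_zero (S : EndJ) : flipAct S 0 = 0 := by simpa using flipAct_smul 0 S 0

theorem ad_e_apply (α : ℂ) (X : G α) :
    ad α (0, 0, jone) X
      = (0, ⟨(2 : ℂ) • L α X.1, Submodule.smul_mem _ _ (L_mem_str α X.1)⟩,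
          -(X.2.1 : EndJ).mulVec jone) := by
  refine G.ext ?_ ?_ ?_
  · simp [ad_apply, bracket_fst, minusAct_zero, flipAct_zero]
  · simp [ad_apply, bracket_snd_fst, bracketZero, L_one, scomm_one_left, jmul_one_left,
      scomm_zero_left, jmul_zero_left, L_zero]
  · simp [ad_apply, bracket_snd_snd, flipAct_one]

theorem ad_f_apply (α : ℂ) (X : G α) :
    ad α (jone, 0, 0) X
      = ((X.2.1 : EndJ).mulVec jone,
          ⟨(-2 : ℂ) • L α X.2.2, Submodule.smul_mem _ _ (L_mem_str α X.2.2)⟩, 0) := by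
  refine G.ext ?_ ?_ ?_
  · simp [ad_apply, bracket_fst, minusAct_zero, flipAct_one, minusAct_mulVec_one]
  · simp [ad_apply, bracket_snd_fst, bracketZero, L_one, scomm_one_left, jmul_one_left,
      scomm_zero_left, jmul_zero_left, L_zero]
  · simp [ad_apply, bracket_snd_snd, flipAct_zero]

-- Since `e` is even, the super Jacobi identity carries no signs when `e` is one of its arguments.
-- This instance is checked in coordinates: four for each of `D_α⁻` and `D_α⁺`, and the nine entries
-- of `StrShape.ext` for the structure algebra.
set_option maxHeartbeats 2000000 in
theorem ad_e_leibniz (α : ℂ) (X Y : G α) :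
    ad α (0, 0, jone) (bracket α X Y)
      = bracket α X (ad α (0, 0, jone) Y) + bracket α (ad α (0, 0, jone) X) Y := by
  obtain ⟨o0, o1, o2, o3⟩ := odd_table
  have hT := mem_str_iff.1 X.2.1.2
  have hS := mem_str_iff.1 Y.2.1.2
  have hT' := hT
  have hS' := hS
  obtain ⟨c1, c2, c3, c4, c5, c6, c7⟩ := hT'
  obtain ⟨d1, d2, d3, d4, d5, d6, d7⟩ := hS'
  refine G.ext (funext fun i => ?_) (StrShape.ext (mem_str_iff.1 (Subtype.property _))
    (mem_str_iff.1 (Subtype.property _)) ?_ ?_ ?_ ?_ ?_ ?_ ?_ ?_ ?_) (funext fun i => ?_)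
  · simp only [ad_e_apply, bracket_fst, bracket_snd_fst, bracketZero, Prod.fst_add, Pi.zero_apply,
      Pi.add_apply, Pi.sub_apply, flipAct_zero, Matrix.mulVec_zero, minusAct_eq hT, minusAct_eq hS,
      minusAct_smul, minusAct_eq (L_shape α _)]
    fin_cases i <;>
    simp [flipAct_apply, Matrix.mulVec, dotProduct, L, jmul, Fin.sum_univ_four, o0, o1, o2,
        o3] <;> grind
  iterate 9
    next =>
      simp only [ad_e_apply, bracket_fst, bracket_snd_fst, bracketZero,
        Prod.snd_add, Prod.fst_add, Submodule.coe_add, Matrix.add_apply,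
        minusAct_eq hT, minusAct_eq hS, jmul_zero_left, jmul_zero_right, L_zero, scomm_zero_left,
        scomm_zero_right]
      simp [flipAct_apply, Matrix.mulVec, dotProduct, L, jmul, Fin.sum_univ_four, o0, o1, o2, o3,
        scomm_apply, jone, c1, c2, c3, c4, c5, c6, d1, d2, d3, d4, d5, d6]
      try grind
  · simp only [ad_e_apply, bracket_snd_fst, bracket_snd_snd, bracketZero, Prod.snd_add,
      Pi.add_apply, Pi.sub_apply]
    fin_cases i <;>
    simp [flipAct_apply, Matrix.mulVec, dotProduct, L, jmul, Fin.sum_univ_four, o0, o1, o2, o3,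
      scomm_apply, jone, c1, c2, c3, c4, c5, c6, d1, d2, d3, d4, d5, d6] <;> grind

set_option maxHeartbeats 2000000 in
theorem ad_f_leibniz (α : ℂ) (X Y : G α) :
    ad α (jone, 0, 0) (bracket α X Y)
      = bracket α X (ad α (jone, 0, 0) Y) + bracket α (ad α (jone, 0, 0) X) Y := by
  obtain ⟨o0, o1, o2, o3⟩ := odd_table
  have hT := mem_str_iff.1 X.2.1.2
  have hS := mem_str_iff.1 Y.2.1.2
  have hT' := hT
  have hS' := hS
  obtain ⟨c1, c2, c3, c4, c5, c6, c7⟩ := hT'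
  obtain ⟨d1, d2, d3, d4, d5, d6, d7⟩ := hS'
  refine G.ext (funext fun i => ?_) (StrShape.ext (mem_str_iff.1 (Subtype.property _))
    (mem_str_iff.1 (Subtype.property _)) ?_ ?_ ?_ ?_ ?_ ?_ ?_ ?_ ?_) (funext fun i => ?_)
  · simp only [ad_f_apply, bracket_fst, bracket_snd_fst, bracketZero, Prod.fst_add, Pi.add_apply,
      Pi.sub_apply, minusAct_eq hT, minusAct_eq hS,
      minusAct_smul, minusAct_eq (L_shape α _)]
    fin_cases i <;>
    simp [flipAct_apply, Matrix.mulVec, dotProduct, L, jmul, Fin.sum_univ_four, o0, o1, o2, o3,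
      scomm_apply, jone, c1, c2, c3, c4, c5, c6, d1, d2, d3, d4, d5, d6] <;> grind
  iterate 9
    next =>
      simp only [ad_f_apply, bracket_snd_fst, bracket_snd_snd, bracketZero,
        Prod.snd_add, Prod.fst_add, Submodule.coe_add, Matrix.add_apply,
        jmul_zero_left, jmul_zero_right, L_zero, scomm_zero_left,
        scomm_zero_right]
      simp [flipAct_apply, Matrix.mulVec, dotProduct, L, jmul, Fin.sum_univ_four, o0, o1, o2, o3,
        scomm_apply, jone, c1, c2, c3, c4, c5, c6, d1, d2, d3, d4, d5, d6]
      try grind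
  · simp only [ad_f_apply, bracket_snd_fst, bracket_snd_snd, bracketZero, Prod.snd_add,
      Pi.zero_apply, Pi.add_apply, Pi.sub_apply, flipAct_zero, Matrix.mulVec_zero]
    fin_cases i <;>
    simp [flipAct_apply, Matrix.mulVec, dotProduct, L, jmul, Fin.sum_univ_four, o0, o1, o2,
        o3] <;> grind

end Cayley

/-! ### The Cayley transform is an even automorphism -/

section CayleyAut

theorem bracket_add_left (α : ℂ) (X X' Y : G α) :
    bracket α (X + X') Y = bracket α X Y + bracket α X' Y := by
  refine G.ext ?_ ?_ ?_
  · simp only [bracket, Prod.fst_add, Prod.snd_add, Submodule.coe_add, minusAct_add,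
      Matrix.add_mulVec, flipAct_add]
    abel
  · simp only [bracket, bracketZero, Prod.fst_add, Prod.snd_add, Submodule.coe_add, jmul_add_left,
      L_add, scomm_add_left, smul_add]
    abel
  · simp only [bracket, Prod.fst_add, Prod.snd_add, Submodule.coe_add, Matrix.add_mulVec,
      flipAct_add]
    abel

theorem bracket_smul_left (α c : ℂ) (X Y : G α) :
    bracket α (c • X) Y = c • bracket α X Y := by
  refine G.ext ?_ ?_ ?_
  · simp only [bracket, Prod.smul_fst, Prod.smul_snd, Submodule.coe_smul, minusAct_smul,
      Matrix.smul_mulVec, flipAct_smul, smul_sub]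
  · simp only [bracket, bracketZero, Prod.smul_fst, Prod.smul_snd, Submodule.coe_smul,
      jmul_smul_left, L_smul, scomm_smul_left, smul_add, smul_comm c (2 : ℂ), smul_comm c (-2 : ℂ)]
  · simp only [bracket, Prod.smul_fst, Prod.smul_snd, Submodule.coe_smul, Matrix.smul_mulVec,
      flipAct_smul, smul_sub]

theorem bracket_add_right (α : ℂ) (X Y Y' : G α) :
    bracket α X (Y + Y') = bracket α X Y + bracket α X Y' := (ad α X).map_add Y Y'

theorem bracket_smul_right (α c : ℂ) (X Y : G α) :
    bracket α X (c • Y) = c • bracket α X Y := (ad α X).map_smul c Y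

/-- The exponential of a nilpotent derivation of `𝔤` preserves the bracket. -/
theorem exp_bracket {α : ℂ} {D : Module.End ℂ (G α)}
    (hD : ∀ X Y, D (bracket α X Y) = bracket α X (D Y) + bracket α (D X) Y)
    (hn : IsNilpotent D) (X Y : G α) :
    IsNilpotent.exp D (bracket α X Y)
      = bracket α (IsNilpotent.exp D X) (IsNilpotent.exp D Y) := by
  -- The exponential of a nilpotent derivation is multiplicative on any nonassociative algebra, so
  -- the bracket is installed locally as a multiplication.
  let _ : NonUnitalNonAssocRing (G α) :=
    { (inferInstance : AddCommGroup (G α)) with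
      mul := bracket α
      left_distrib := bracket_add_right α
      right_distrib := bracket_add_left α
      zero_mul := fun Y => by simpa using! bracket_smul_left α 0 0 Y
      mul_zero := fun X => by simpa using! bracket_smul_right α 0 X 0 }
  have : SMulCommClass ℂ (G α) (G α) := ⟨fun c X Y => (bracket_smul_right α c X Y).symm⟩
  have : IsScalarTower ℂ (G α) (G α) := ⟨fun c X Y => bracket_smul_left α c X Y⟩
  exact Module.End.exp_mul_of_derivation ℂ (G α) D hD hn X Y

/-- The homogeneous elements of a given parity form a subspace. -/
def homog (α : ℂ) (i : Fin 2) : Submodule ℂ (G α) where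
  carrier := {X | IsHomog i X}
  add_mem' := by
    intro X Y hX hY
    simp only [Set.mem_ofPred_eq, IsHomog, Prod.fst_add, Prod.snd_add, Submodule.coe_add, oddV_add,
      oddM_add] at hX hY ⊢
    split_ifs at hX hY ⊢ <;> simp [hX, hY]
  zero_mem' := by
    simp only [Set.mem_ofPred_eq, IsHomog, Prod.fst_zero, Prod.snd_zero, Submodule.coe_zero,
      oddV_zero, oddM_zero]
    split_ifs <;> simp
  smul_mem' := by
    intro c X hX
    simp only [Set.mem_ofPred_eq, IsHomog, Prod.smul_fst, Prod.smul_snd, Submodule.coe_smul,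
      oddV_smul, oddM_smul] at hX ⊢
    split_ifs at hX ⊢ <;> simp [hX]

theorem mem_homog {α : ℂ} {i : Fin 2} {X : G α} : X ∈ homog α i ↔ IsHomog i X := Iff.rfl

theorem exp_mem {α : ℂ} {S : Submodule ℂ (G α)}
    {D : Module.End ℂ (G α)} (hD : ∀ v ∈ S, D v ∈ S) {v : G α} (hv : v ∈ S) :
    IsNilpotent.exp D v ∈ S := by
  have hp : ∀ n : ℕ, (D ^ n) v ∈ S := by
    intro n
    induction n with
    | zero => simpa using hv
    | succ n ih => rw [pow_succ', Module.End.mul_apply]; exact hD _ ih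
  rw [IsNilpotent.exp, LinearMap.sum_apply]
  refine Submodule.sum_mem _ fun n _ => ?_
  -- The coefficients of the exponential are rational scalars, whereas `S` is a complex subspace.
  rw [LinearMap.smul_apply, ← Rat.cast_smul_eq_qsmul ℂ]
  exact S.smul_mem _ (hp n)

theorem oddM_L (α : ℂ) (x : J) : oddM (L α x) = L α (oddV x) := by
  obtain ⟨o0, o1, o2, o3⟩ := odd_table
  ext i j
  fin_cases i <;> fin_cases j <;> simp [oddM, oddV, L, jmul, o0, o1, o2, o3]

theorem oddV_mulVec_one (T : EndJ) : oddV (T.mulVec jone) = (oddM T).mulVec jone := by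
  obtain ⟨o0, o1, o2, o3⟩ := odd_table
  ext i
  fin_cases i <;> simp [oddM, oddV, Matrix.mulVec, dotProduct, Fin.sum_univ_four, jone, o0, o1,
      o2, o3]

theorem oddV_neg (x : J) : oddV (-x) = -oddV x := by simpa using oddV_smul (-1) x

theorem ad_e_homog {α : ℂ} {i : Fin 2} {X : G α} (hX : IsHomog i X) :
    IsHomog i (ad α (0, 0, jone) X) := by
  rw [ad_e_apply]
  simp only [IsHomog] at hX ⊢
  split_ifs at hX ⊢ <;>
  simp [oddV_zero, oddM_smul, oddM_L, oddV_neg, oddV_mulVec_one, hX, L_zero]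

theorem ad_f_homog {α : ℂ} {i : Fin 2} {X : G α} (hX : IsHomog i X) :
    IsHomog i (ad α (jone, 0, 0) X) := by
  rw [ad_f_apply]
  simp only [IsHomog] at hX ⊢
  split_ifs at hX ⊢ <;>
  simp only [oddV_zero, oddM_smul, oddM_L, oddV_mulVec_one, hX, L_zero] <;> simp

/-- The operator `ad e` moves one step along `D_α⁻ → str → D_α⁺ → 0`, so its cube vanishes. The
operator `ad f` moves in the opposite direction. -/
theorem ad_e_nilpotent (α c : ℂ) : IsNilpotent (c • ad α (0, 0, jone)) := by
  refine IsNilpotent.smul ⟨3, ?_⟩ c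
  refine LinearMap.ext fun X => ?_
  simp only [pow_succ, pow_zero, one_mul, Module.End.mul_apply, ad_e_apply, L_zero]
  refine G.ext ?_ ?_ ?_ <;> simp

theorem ad_f_nilpotent (α c : ℂ) : IsNilpotent (c • ad α (jone, 0, 0)) := by
  refine IsNilpotent.smul ⟨3, ?_⟩ c
  refine LinearMap.ext fun X => ?_
  simp only [pow_succ, pow_zero, one_mul, Module.End.mul_apply, ad_f_apply]
  refine G.ext ?_ ?_ ?_ <;> simp [L_zero]

theorem cayley_bracket (α : ℂ) (X Y : G α) :
    cayley α (bracket α X Y) = bracket α (cayley α X) (cayley α Y) := by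
  simp only [cayley, Module.End.mul_apply]
  rw [exp_bracket _ (ad_e_nilpotent α _), exp_bracket _ (ad_f_nilpotent α _)]
  · intro X Y
    simp only [LinearMap.smul_apply, ad_f_leibniz, bracket_smul_left, bracket_smul_right, smul_add]
  · intro X Y
    simp only [LinearMap.smul_apply, ad_e_leibniz, bracket_smul_left, bracket_smul_right, smul_add]

/-- Both units are even. Parity must be kept because the relations of `U(𝔤)` are imposed on
homogeneous elements only. -/
theorem cayley_homog {α : ℂ} {i : Fin 2} {X : G α} (hX : IsHomog i X) :
    IsHomog i (cayley α X) := by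
  rw [← mem_homog] at hX ⊢
  rw [cayley, Module.End.mul_apply]
  refine exp_mem (fun Y hY => ?_) (exp_mem (fun Y hY => ?_) hX)
  · exact Submodule.smul_mem _ _ (ad_f_homog hY)
  · exact Submodule.smul_mem _ _ (ad_e_homog hY)

/-- Exponentials of nilpotent operators are invertible. Hence twisting by the Cayley transform does
not change the set of operators by which `𝔤` acts, nor the filtration they generate. -/
theorem cayley_surjective (α : ℂ) : Function.Surjective (cayley α) := by
  have h : IsUnit (cayley α) :=
    (IsNilpotent.isUnit_exp (ad_f_nilpotent α _)).mul (IsNilpotent.isUnit_exp (ad_e_nilpotent α _))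
  exact ((Module.End.isUnit_iff _).1 h).2

end CayleyAut

/-! ### Superpolynomials in coordinates -/

section Superpolynomials

/-- The odd generators of the exterior algebra. -/
def extGen (i : Fin 2) : ExteriorAlgebra ℂ (Fin 2 → ℂ) := ExteriorAlgebra.ι ℂ (Pi.single i 1)

theorem extGen_sq (i : Fin 2) : extGen i * extGen i = 0 := ExteriorAlgebra.ι_sq_zero _

theorem extGen_swap : extGen 1 * extGen 0 = -(extGen 0 * extGen 1) :=
  eq_neg_of_add_eq_zero_left (ExteriorAlgebra.ι_add_mul_swap _ _)

theorem ι_eq_extGen (v : Fin 2 → ℂ) :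
    ExteriorAlgebra.ι ℂ v = v 0 • extGen 0 + v 1 • extGen 1 := by
  rw [extGen, extGen, ← map_smul, ← map_smul, ← map_add]
  congr 1
  ext i; fin_cases i <;> simp

theorem oddDeriv_one (i : Fin 2) : oddDeriv i 1 = 0 := by
  simp [oddDeriv]

theorem oddDeriv_mul (i j : Fin 2) (w : ExteriorAlgebra ℂ (Fin 2 → ℂ)) :
    oddDeriv i (extGen j * w) = (if i = j then (1 : ℂ) else 0) • w - extGen j * oddDeriv i w := by
  have := CliffordAlgebra.contractLeft_ι_mul (Q := (0 : QuadraticForm ℂ (Fin 2 → ℂ)))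
    (LinearMap.proj i : Module.Dual ℂ (Fin 2 → ℂ)) (Pi.single j 1) w
  simpa [oddDeriv, extGen, Pi.single_apply] using! this

theorem oddDeriv_extGen (i j : Fin 2) :
    oddDeriv i (extGen j) = if i = j then 1 else 0 := by
  have := oddDeriv_mul i j 1
  simpa [oddDeriv_one] using this

/-- The superpolynomial with given coefficients of `1, z₃, z₄, z₃ z₄`. -/
def superPoly (q : Fin 4 → MvPolynomial (Fin 2) ℂ) : P :=
  q 0 ⊗ₜ 1 + q 1 ⊗ₜ extGen 0 + q 2 ⊗ₜ extGen 1 + q 3 ⊗ₜ (extGen 0 * extGen 1)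

theorem superPoly_add (q r : Fin 4 → MvPolynomial (Fin 2) ℂ) :
    superPoly (q + r) = superPoly q + superPoly r := by
  simp only [superPoly, Pi.add_apply, TensorProduct.add_tmul]; abel

theorem superPoly_smul (c : ℂ) (q : Fin 4 → MvPolynomial (Fin 2) ℂ) :
    superPoly (c • q) = c • superPoly q := by
  simp only [superPoly, Pi.smul_apply, TensorProduct.smul_tmul', smul_add]

theorem superPoly_zero : superPoly 0 = 0 := by simp [superPoly]

theorem tmul_eq_superPoly (p : MvPolynomial (Fin 2) ℂ) (w : ExteriorAlgebra ℂ (Fin 2 → ℂ)) :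
    ∃ q, p ⊗ₜ w = superPoly q := by
  suffices h : ∃ c : Fin 4 → ℂ,
      w = c 0 • 1 + c 1 • extGen 0 + c 2 • extGen 1 + c 3 • (extGen 0 * extGen 1) by
    obtain ⟨c, rfl⟩ := h
    refine ⟨fun i => c i • p, ?_⟩
    simp only [superPoly, TensorProduct.tmul_add, TensorProduct.smul_tmul, TensorProduct.tmul_smul]
  induction w using CliffordAlgebra.left_induction with
  | algebraMap r => exact ⟨![r, 0, 0, 0], by simp [Algebra.algebraMap_eq_smul_one]⟩
  | add x y hx hy =>
    obtain ⟨c, rfl⟩ := hx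
    obtain ⟨d, rfl⟩ := hy
    exact ⟨c + d, by simp only [Pi.add_apply]; module⟩
  | ι_mul x v hx =>
    obtain ⟨c, rfl⟩ := hx
    -- Multiplication by `v` on the left: the minus sign comes from `extGen 1 * extGen 0 = -(extGen
    -- 0 * extGen 1)`, and the top term is killed.
    refine ⟨![0, c 0 * v 0, c 0 * v 1, c 2 * v 0 - c 1 * v 1], ?_⟩
    have h00 : extGen 0 * (extGen 0 * extGen 1) = 0 := by
      rw [← mul_assoc, extGen_sq, zero_mul]
    have h10 : extGen 1 * (extGen 0 * extGen 1) = 0 := by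
      rw [← mul_assoc, extGen_swap, neg_mul, mul_assoc, extGen_sq, mul_zero, neg_zero]
    change ExteriorAlgebra.ι ℂ v * _ = _
    simp only [ι_eq_extGen, add_mul, mul_add, smul_mul_assoc, mul_smul_comm, mul_one, extGen_sq,
      extGen_swap, h00, h10]
    simp
    module

/-- Uniqueness of the coefficients is never needed: the projection to the model is defined on the
tensor product itself, and coordinates serve only to compute it. -/
theorem exists_superPoly (p : P) : ∃ q, p = superPoly q := by
  induction p using TensorProduct.induction_on with
  | zero => exact ⟨0, superPoly_zero.symm⟩
  | tmul p w => exact tmul_eq_superPoly p w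
  | add x y hx hy =>
    obtain ⟨q, rfl⟩ := hx
    obtain ⟨r, rfl⟩ := hy
    exact ⟨q + r, (superPoly_add q r).symm⟩

open MvPolynomial in
theorem Z_superPoly (q : Fin 4 → MvPolynomial (Fin 2) ℂ) :
    Z 0 (superPoly q) = superPoly ![X 0 * q 0, X 0 * q 1, X 0 * q 2, X 0 * q 3] ∧
    Z 1 (superPoly q) = superPoly ![X 1 * q 0, X 1 * q 1, X 1 * q 2, X 1 * q 3] ∧
    Z 2 (superPoly q) = superPoly ![0, q 0, 0, q 2] ∧
    Z 3 (superPoly q) = superPoly ![0, 0, q 0, -q 1] := by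
  have h00 : extGen 0 * (extGen 0 * extGen 1) = 0 := by
    rw [← mul_assoc, extGen_sq, zero_mul]
  have h10 : extGen 1 * (extGen 0 * extGen 1) = 0 := by
    rw [← mul_assoc, extGen_swap, neg_mul, mul_assoc, extGen_sq, mul_zero, neg_zero]
  have e0 : ExteriorAlgebra.ι ℂ (Pi.single (0 : Fin 2) (1 : ℂ)) = extGen 0 := rfl
  have e1 : ExteriorAlgebra.ι ℂ (Pi.single (1 : Fin 2) (1 : ℂ)) = extGen 1 := rfl
  refine ⟨?_, ?_, ?_, ?_⟩ <;>
  simp [Z, z, superPoly, mul_add, e0, e1, extGen_sq, extGen_swap, h00, h10, TensorProduct.neg_tmul,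
    TensorProduct.tmul_neg]

open MvPolynomial in
theorem pd_superPoly (q : Fin 4 → MvPolynomial (Fin 2) ℂ) :
    pd 0 (superPoly q)
      = superPoly ![pderiv 0 (q 0), pderiv 0 (q 1), pderiv 0 (q 2), pderiv 0 (q 3)] ∧
    pd 1 (superPoly q)
      = superPoly ![pderiv 1 (q 0), pderiv 1 (q 1), pderiv 1 (q 2), pderiv 1 (q 3)] ∧
    pd 2 (superPoly q) = superPoly ![q 1, 0, q 3, 0] ∧
    pd 3 (superPoly q) = superPoly ![q 2, -q 3, 0, 0] := by
  refine ⟨?_, ?_, ?_, ?_⟩ <;>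
  simp [pd, superPoly, oddDeriv_one, oddDeriv_mul, oddDeriv_extGen, TensorProduct.neg_tmul,
    TensorProduct.tmul_neg]

end Superpolynomials

/-! ### The projection to the model intertwines the actions -/

section Projection

open MvPolynomial

/-- Restriction of a polynomial to the line `s = 0`. -/
def evalLine (t : Fin 2) : MvPolynomial (Fin 2) ℂ →ₐ[ℂ] Polynomial ℂ :=
  aeval (Pi.single t Polynomial.X)

theorem evalLine_pderiv (t : Fin 2) (p : MvPolynomial (Fin 2) ℂ) :
    evalLine t (pderiv t p) = Polynomial.derivative (evalLine t p) := by
  induction p using MvPolynomial.induction_on with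
  | C a => simp [evalLine]
  | add p q hp hq => simp [hp, hq]
  | mul_X p n h =>
    by_cases hn : n = t
    · subst hn
      simp [Derivation.leibniz, h]
      simp [evalLine]
      ring
    · simp [Derivation.leibniz, h, pderiv_X_of_ne hn]
      simp [evalLine, hn]

theorem pderiv_comm (i j : Fin 2) (p : MvPolynomial (Fin 2) ℂ) :
    pderiv i (pderiv j p) = pderiv j (pderiv i p) := by
  let D : Fin 2 → Derivation ℂ (MvPolynomial (Fin 2) ℂ) (MvPolynomial (Fin 2) ℂ) := pderiv
  have h : ⁅D i, D j⁆ = 0 := by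
    refine derivation_ext fun k => ?_
    simp only [D, Derivation.commutator_apply, pderiv_X, Pi.single_apply, Derivation.coe_zero,
      Pi.zero_apply]
    split_ifs <;> simp
  have := DFunLike.congr_fun h p
  rwa [Derivation.commutator_apply, Derivation.coe_zero, Pi.zero_apply, sub_eq_zero] at this

/-- The action of the odd variables on the model. -/
def modelOdd (κ : ℂ) : (Fin 2 → ℂ) →ₗ[ℂ] Module.End ℂ FockModel where
  -- The value 0 for `ν` is arbitrary: `ν` enters `oddOp` only together with entries of `M` or `x`,
  -- which vanish here.
  toFun v := oddOp 0 κ (v 0) (v 1) 0 0 0 0 0 0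
  map_add' v w := by simp [← oddOp_add]
  map_smul' c v := by simp [← oddOp_smul]

theorem modelOdd_sq (κ : ℂ) (v : Fin 2 → ℂ) : modelOdd κ v * modelOdd κ v = 0 := by
  refine LinearMap.ext fun n => funext fun i => ?_
  fin_cases i <;> simp [modelOdd, oddOp]
  ring

/-- The vacuum of the model. -/
def modelVac : FockModel := ![1, 0, 0, 0]

/-- The action of the exterior algebra on the vacuum of the model. -/
def extProj (κ : ℂ) : ExteriorAlgebra ℂ (Fin 2 → ℂ) →ₗ[ℂ] FockModel :=
  LinearMap.applyₗ modelVac ∘ₗ (ExteriorAlgebra.lift ℂ ⟨modelOdd κ, modelOdd_sq κ⟩).toLinearMap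

theorem extProj_one (κ : ℂ) : extProj κ 1 = modelVac := by simp [extProj]

theorem extProj_extGen_mul (κ : ℂ) (i : Fin 2) (w : ExteriorAlgebra ℂ (Fin 2 → ℂ)) :
    extProj κ (extGen i * w) = modelOdd κ (Pi.single i 1) (extProj κ w) := by
  simp [extProj, extGen]

theorem extProj_extGen (κ : ℂ) (i : Fin 2) :
    extProj κ (extGen i) = modelOdd κ (Pi.single i 1) modelVac := by
  simpa [extProj_one] using extProj_extGen_mul κ i 1

/-- The projection of the superpolynomials onto the model. -/
def modelProj (κ : ℂ) (t s : Fin 2) : P →ₗ[ℂ] FockModel :=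
  TensorProduct.lift <| LinearMap.mk₂ ℂ
    -- First-order Taylor expansion of `p` in `s`. The linear term multiplies by `s`, which keeps
    -- only the component along `1` because `s² = s z₃ = s z₄ = 0`.
    (fun p w => evalLine t p • extProj κ w
      + evalLine t (pderiv s p) • (![0, extProj κ w 0, 0, 0] : FockModel))
    (fun p p' w => by simp only [map_add, add_smul]; abel)
    (fun c p w => by
      simp only [map_smul, Derivation.map_smul, smul_assoc, smul_add])
    (fun p w w' => by
      have : (![0, extProj κ (w + w') 0, 0, 0] : FockModel)
          = ![0, extProj κ w 0, 0, 0] + ![0, extProj κ w' 0, 0, 0] := by simp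
      rw [this, map_add]; simp only [smul_add]; abel)
    (fun c p w => by
      have : (![0, extProj κ (c • w) 0, 0, 0] : FockModel)
          = c • ![0, extProj κ w 0, 0, 0] := by simp
      rw [this, map_smul, smul_add, smul_comm c, smul_comm c])

theorem modelProj_tmul (κ : ℂ) (t s : Fin 2) (p : MvPolynomial (Fin 2) ℂ)
    (w : ExteriorAlgebra ℂ (Fin 2 → ℂ)) :
    modelProj κ t s (p ⊗ₜ w) = evalLine t p • extProj κ w
      + evalLine t (pderiv s p) • (![0, extProj κ w 0, 0, 0] : FockModel) := rfl

theorem modelProj_superPoly (κ : ℂ) (t s : Fin 2) (q : Fin 4 → MvPolynomial (Fin 2) ℂ) :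
    modelProj κ t s (superPoly q) =
      ![evalLine t (q 0),
        evalLine t (pderiv s (q 0)) + Polynomial.C κ * Polynomial.X * evalLine t (q 3),
        evalLine t (q 1), evalLine t (q 2)] := by
  funext i
  fin_cases i <;>
  simp [superPoly, modelProj_tmul, extProj_one, extProj_extGen, extProj_extGen_mul, modelOdd,
    oddOp, modelVac]
  ring

theorem piRep_apply (α lam : ℂ) (X : G α) (p : P) :
    piRep α lam X p = (∑ i, (-2 * Complex.I * X.1 i) • Z i p)
    + (strChar α lam X.2.1 • p + ∑ j, ∑ i, minusAct α X.2.1 i j • Z i (pd j p))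
    + ∑ i, (-(Complex.I / 2) * X.2.2 i) • bessel α lam i p := by
  simp only [piRep, LinearMap.add_apply, LinearMap.sum_apply, LinearMap.smul_apply,
    Module.End.one_apply, Module.End.mul_apply]

theorem superPoly_neg (q : Fin 4 → MvPolynomial (Fin 2) ℂ) :
    superPoly (-q) = -superPoly q := by
  simp only [superPoly, Pi.neg_apply, TensorProduct.neg_tmul]; abel

theorem superPoly_sub (q r : Fin 4 → MvPolynomial (Fin 2) ℂ) :
    superPoly (q - r) = superPoly q - superPoly r := by
  rw [sub_eq_add_neg, superPoly_add, superPoly_neg, ← sub_eq_add_neg]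

set_option maxHeartbeats 2000000 in
set_option maxHeartbeats 2000000 in
theorem exists_superPoly_cons (p : P) : ∃ q0 q1 q2 q3, p = superPoly ![q0, q1, q2, q3] := by
  obtain ⟨q, rfl⟩ := exists_superPoly p
  exact ⟨q 0, q 1, q 2, q 3, by simp [superPoly]⟩

/-- The operator `π_λ(T)` then depends only on the matrix of `T` on `D_α⁻`: this matrix obeys the
same linear relations as `T` and determines the character. The matrix can therefore be treated as a
generic one of that shape. -/
theorem minusAct_shape {α : ℂ} {T : EndJ} (hT : T ∈ str α) (lam : ℂ) :
    StrShape α (minusAct α T) ∧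
      strChar α lam T = -(minusAct α T 0 0 * lam + minusAct α T 1 1 * (lam / α)) / 2 := by
  have h := mem_str_iff.1 hT
  constructor
  · exact mem_str_iff.1 (sub_mem hT (Submodule.smul_mem _ _ (L_mem_str α _)))
  · simp [minusAct_eq h, strChar, Matrix.mulVec, dotProduct, Fin.sum_univ_four, jone, h.1, h.2.1]
    ring

-- This gives the invariance of the ideal under `π_λ`. It rests on `λ / α = 1`: the Bessel operator
-- of `s = z₂` contains `(-1 + s∂ₛ)∂ₛ`, which kills `s²`. The cross term with `∂₃∂₄` is compensated
-- by `z₃ z₄ = -2 t s`.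
set_option maxHeartbeats 2000000 in
theorem modelProj_piRep {α : ℂ} (hα : α ≠ 0) (X : G α) (p : P) :
    modelProj (-2) 0 1 (piRep α α X p)
      = modelRep α (-2) 0 1 X (modelProj (-2) 0 1 p) := by
  obtain ⟨q0, q1, q2, q3, rfl⟩ := exists_superPoly_cons p
  have z0 := fun q => (Z_superPoly q).1
  have z1 := fun q => (Z_superPoly q).2.1
  have z2 := fun q => (Z_superPoly q).2.2.1
  have z3 := fun q => (Z_superPoly q).2.2.2
  have d0 := fun q => (pd_superPoly q).1
  have d1 := fun q => (pd_superPoly q).2.1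
  have d2 := fun q => (pd_superPoly q).2.2.1
  have d3 := fun q => (pd_superPoly q).2.2.2
  have x0 : evalLine 0 (MvPolynomial.X 0) = Polynomial.X := by simp [evalLine]
  have x1 : evalLine 0 (MvPolynomial.X 1) = 0 := by simp [evalLine]
  have e1 : ∀ a b : MvPolynomial (Fin 2) ℂ, evalLine 0 (a + b) = evalLine 0 a + evalLine 0 b :=
      map_add _
  have e2 : ∀ a b : MvPolynomial (Fin 2) ℂ, evalLine 0 (a - b) = evalLine 0 a - evalLine 0 b :=
      map_sub _
  have e3 : ∀ a : MvPolynomial (Fin 2) ℂ, evalLine 0 (-a) = -evalLine 0 a := map_neg _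
  have e4 : ∀ (c : ℂ) (a : MvPolynomial (Fin 2) ℂ), evalLine 0 (c • a) =
      Polynomial.C c * evalLine 0 a := fun c a => by
    rw [map_smul, Polynomial.smul_eq_C_mul]
  have e5 : ∀ a : MvPolynomial (Fin 2) ℂ, evalLine 0 (MvPolynomial.X 0 * a) =
      Polynomial.X * evalLine 0 a := fun a => by
    rw [map_mul, x0]
  have e6 : ∀ a : MvPolynomial (Fin 2) ℂ, evalLine 0 (MvPolynomial.X 1 * a) = 0 := fun a => by
    rw [map_mul, x1, zero_mul]
  have e7 : evalLine 0 0 = 0 := map_zero _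
  have p1 : ∀ a b : MvPolynomial (Fin 2) ℂ, pderiv (1 : Fin 2) (a + b) = pderiv 1 a + pderiv 1 b :=
    fun a b => map_add (pderiv (1 : Fin 2) : Derivation ℂ (MvPolynomial (Fin 2) ℂ) _) a b
  have p2 : ∀ a b : MvPolynomial (Fin 2) ℂ, pderiv (1 : Fin 2) (a - b) = pderiv 1 a - pderiv 1 b :=
    fun a b => map_sub (pderiv (1 : Fin 2) : Derivation ℂ (MvPolynomial (Fin 2) ℂ) _) a b
  have p3 : ∀ a : MvPolynomial (Fin 2) ℂ, pderiv (1 : Fin 2) (-a) = -pderiv 1 a :=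
    fun a => map_neg (pderiv (1 : Fin 2) : Derivation ℂ (MvPolynomial (Fin 2) ℂ) _) a
  have p4 : ∀ (c : ℂ) (a : MvPolynomial (Fin 2) ℂ), pderiv (1 : Fin 2) (c • a) = c • pderiv 1 a :=
    fun c a => (pderiv (1 : Fin 2)).map_smul c a
  have p5 : ∀ a : MvPolynomial (Fin 2) ℂ, pderiv (1 : Fin 2) (MvPolynomial.X 0 * a)
      = (MvPolynomial.X 0 * pderiv 1 a : MvPolynomial (Fin 2) ℂ) := fun a => by
    rw [pderiv_mul, pderiv_X_of_ne (by decide), zero_mul, zero_add]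
  have p6 : ∀ a : MvPolynomial (Fin 2) ℂ, pderiv (1 : Fin 2) (MvPolynomial.X 1 * a)
      = (a + MvPolynomial.X 1 * pderiv 1 a : MvPolynomial (Fin 2) ℂ) := fun a => by
    rw [pderiv_mul, pderiv_X_self, one_mul]
  have p7 : pderiv (1 : Fin 2) (0 : MvPolynomial (Fin 2) ℂ) = 0 := map_zero _
  have hd : ∀ r, evalLine 0 (pderiv 1 (pderiv 0 r))
      = Polynomial.derivative (evalLine 0 (pderiv 1 r)) := fun r => by
    rw [pderiv_comm, evalLine_pderiv]
  have hαα : α * α⁻¹ = 1 := mul_inv_cancel₀ hα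
  obtain ⟨hM, hχ⟩ := minusAct_shape X.2.1.2 α
  simp only [piRep_apply, Fin.sum_univ_four, bessel, Matrix.cons_val_zero, Matrix.cons_val_one,
    Matrix.cons_val, LinearMap.add_apply, LinearMap.sub_apply, LinearMap.smul_apply,
    Module.End.mul_apply, Module.End.one_apply, z0, z1, z2, z3, d0, d1, d2, d3, ← superPoly_smul,
    ← superPoly_add, ← superPoly_sub, modelProj_superPoly, modelRep, hχ]
  generalize minusAct α X.2.1 = M at hM ⊢
  obtain ⟨c1, c2, c3, c4, c5, c6, c7⟩ := hM
  have c7 := eq_sub_of_add_eq' c7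
  simp only [evenOp, oddOp, LinearMap.coe_mk, AddHom.coe_mk, Pi.add_apply, Pi.sub_apply,
    Pi.smul_apply, Matrix.cons_val_zero, Matrix.cons_val_one, Matrix.cons_val, c1, c2, c3, c4, c5,
    c6, c7]
  clear c1 c2 c3 c4 c5 c6 c7
  generalize M 0 0 = m00
  generalize M 1 1 = m11
  generalize M 2 2 = m22
  generalize M 2 3 = m23
  generalize M 3 2 = m32
  generalize M 2 0 = m20
  generalize M 2 1 = m21
  generalize M 3 0 = m30
  generalize M 3 1 = m31
  generalize X.1 0 = u0
  generalize X.1 1 = u1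
  generalize X.1 2 = u2
  generalize X.1 3 = u3
  generalize X.2.2 0 = v0
  generalize X.2.2 1 = v1
  generalize X.2.2 2 = v2
  generalize X.2.2 3 = v3
  funext i
  fin_cases i
  all_goals
    simp only [Pi.add_apply, Fin.zero_eta, Fin.mk_one, Fin.reduceFinMk,
      Matrix.cons_val_zero, Matrix.cons_val_one, Matrix.cons_val]
    simp only [p1, p2, p3, p4, p5, p6, p7, e1, e2, e3, e4, e5, e6, e7, evalLine_pderiv, hd,
      hαα, div_eq_mul_inv,
      Polynomial.C_add, Polynomial.C_sub, Polynomial.C_neg, Polynomial.C_mul, Polynomial.C_1,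
      Polynomial.C_0, Polynomial.C_ofNat, Polynomial.derivative_add, Polynomial.derivative_mul,
      Polynomial.derivative_neg,
      Polynomial.derivative_ofNat, Polynomial.derivative_zero, Polynomial.derivative_X, zero_mul,
      mul_zero, add_zero, zero_add,
      sub_zero, neg_zero, mul_one]
    -- The model does not record second derivatives in `s`, so `c0` has to cancel; its two
    -- contributions are `-c0` from the constant of the Bessel operator and `c0` from `s∂ₛ²`.
    generalize evalLine 0 (pderiv 1 (pderiv 1 q0)) = c0
    generalize evalLine 0 (pderiv 1 q0) = b0
    generalize evalLine 0 (pderiv 1 q1) = b1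
    generalize evalLine 0 (pderiv 1 q2) = b2
    generalize evalLine 0 (pderiv 1 q3) = b3
    generalize evalLine 0 q0 = a0
    generalize evalLine 0 q1 = a1
    generalize evalLine 0 q2 = a2
    generalize evalLine 0 q3 = a3
    ring
set_option maxHeartbeats 2000000 in
theorem modelProj_piRep_swap {α : ℂ} (hα : α ≠ 0) (X : G α) (p : P) :
    modelProj (-2 * α) 1 0 (piRep α 1 X p)
      = modelRep α⁻¹ (-2 * α) 1 0 X (modelProj (-2 * α) 1 0 p) := by
  obtain ⟨q0, q1, q2, q3, rfl⟩ := exists_superPoly_cons p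
  have z0 := fun q => (Z_superPoly q).1
  have z1 := fun q => (Z_superPoly q).2.1
  have z2 := fun q => (Z_superPoly q).2.2.1
  have z3 := fun q => (Z_superPoly q).2.2.2
  have d0 := fun q => (pd_superPoly q).1
  have d1 := fun q => (pd_superPoly q).2.1
  have d2 := fun q => (pd_superPoly q).2.2.1
  have d3 := fun q => (pd_superPoly q).2.2.2
  have x0 : evalLine 1 (MvPolynomial.X 1) = Polynomial.X := by simp [evalLine]
  have x1 : evalLine 1 (MvPolynomial.X 0) = 0 := by simp [evalLine]
  have e1 : ∀ a b : MvPolynomial (Fin 2) ℂ, evalLine 1 (a + b) = evalLine 1 a + evalLine 1 b :=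
      map_add _
  have e2 : ∀ a b : MvPolynomial (Fin 2) ℂ, evalLine 1 (a - b) = evalLine 1 a - evalLine 1 b :=
      map_sub _
  have e3 : ∀ a : MvPolynomial (Fin 2) ℂ, evalLine 1 (-a) = -evalLine 1 a := map_neg _
  have e4 : ∀ (c : ℂ) (a : MvPolynomial (Fin 2) ℂ), evalLine 1 (c • a) =
      Polynomial.C c * evalLine 1 a := fun c a => by
    rw [map_smul, Polynomial.smul_eq_C_mul]
  have e5 : ∀ a : MvPolynomial (Fin 2) ℂ, evalLine 1 (MvPolynomial.X 1 * a) =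
      Polynomial.X * evalLine 1 a := fun a => by
    rw [map_mul, x0]
  have e6 : ∀ a : MvPolynomial (Fin 2) ℂ, evalLine 1 (MvPolynomial.X 0 * a) = 0 := fun a => by
    rw [map_mul, x1, zero_mul]
  have e7 : evalLine 1 0 = 0 := map_zero _
  have p1 : ∀ a b : MvPolynomial (Fin 2) ℂ, pderiv (0 : Fin 2) (a + b) = pderiv 0 a + pderiv 0 b :=
    fun a b => map_add (pderiv (0 : Fin 2) : Derivation ℂ (MvPolynomial (Fin 2) ℂ) _) a b
  have p2 : ∀ a b : MvPolynomial (Fin 2) ℂ, pderiv (0 : Fin 2) (a - b) = pderiv 0 a - pderiv 0 b :=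
    fun a b => map_sub (pderiv (0 : Fin 2) : Derivation ℂ (MvPolynomial (Fin 2) ℂ) _) a b
  have p3 : ∀ a : MvPolynomial (Fin 2) ℂ, pderiv (0 : Fin 2) (-a) = -pderiv 0 a :=
    fun a => map_neg (pderiv (0 : Fin 2) : Derivation ℂ (MvPolynomial (Fin 2) ℂ) _) a
  have p4 : ∀ (c : ℂ) (a : MvPolynomial (Fin 2) ℂ), pderiv (0 : Fin 2) (c • a) = c • pderiv 0 a :=
    fun c a => (pderiv (0 : Fin 2)).map_smul c a
  have p5 : ∀ a : MvPolynomial (Fin 2) ℂ, pderiv (0 : Fin 2) (MvPolynomial.X 1 * a)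
      = (MvPolynomial.X 1 * pderiv 0 a : MvPolynomial (Fin 2) ℂ) := fun a => by
    rw [pderiv_mul, pderiv_X_of_ne (by decide), zero_mul, zero_add]
  have p6 : ∀ a : MvPolynomial (Fin 2) ℂ, pderiv (0 : Fin 2) (MvPolynomial.X 0 * a)
      = (a + MvPolynomial.X 0 * pderiv 0 a : MvPolynomial (Fin 2) ℂ) := fun a => by
    rw [pderiv_mul, pderiv_X_self, one_mul]
  have p7 : pderiv (0 : Fin 2) (0 : MvPolynomial (Fin 2) ℂ) = 0 := map_zero _
  have hd : ∀ r, evalLine 1 (pderiv 0 (pderiv 1 r))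
      = Polynomial.derivative (evalLine 1 (pderiv 0 r)) := fun r => by
    rw [pderiv_comm, evalLine_pderiv]
  have hαα : Polynomial.C α * Polynomial.C α⁻¹ = 1 := by
    rw [← Polynomial.C_mul, mul_inv_cancel₀ hα, Polynomial.C_1]
  obtain ⟨hM, hχ⟩ := minusAct_shape X.2.1.2 1
  simp only [piRep_apply, Fin.sum_univ_four, bessel, Matrix.cons_val_zero, Matrix.cons_val_one,
    Matrix.cons_val, LinearMap.add_apply, LinearMap.sub_apply, LinearMap.smul_apply,
    Module.End.mul_apply, Module.End.one_apply, z0, z1, z2, z3, d0, d1, d2, d3, ← superPoly_smul,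
    ← superPoly_add, ← superPoly_sub, modelProj_superPoly, modelRep, hχ]
  generalize minusAct α X.2.1 = M at hM ⊢
  obtain ⟨c1, c2, c3, c4, c5, c6, c7⟩ := hM
  have c7 := eq_sub_of_add_eq' c7
  simp only [evenOp, oddOp, LinearMap.coe_mk, AddHom.coe_mk, Pi.add_apply, Pi.sub_apply,
    Pi.smul_apply, Matrix.cons_val_zero, Matrix.cons_val_one, Matrix.cons_val, c1, c2, c3, c4, c5,
    c6, c7]
  clear c1 c2 c3 c4 c5 c6 c7
  generalize M 0 0 = m00
  generalize M 1 1 = m11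
  generalize M 2 2 = m22
  generalize M 2 3 = m23
  generalize M 3 2 = m32
  generalize M 2 0 = m20
  generalize M 2 1 = m21
  generalize M 3 0 = m30
  generalize M 3 1 = m31
  generalize X.1 0 = u0
  generalize X.1 1 = u1
  generalize X.1 2 = u2
  generalize X.1 3 = u3
  generalize X.2.2 0 = v0
  generalize X.2.2 1 = v1
  generalize X.2.2 2 = v2
  generalize X.2.2 3 = v3
  funext i
  fin_cases i
  all_goals
    simp only [Pi.add_apply, Fin.zero_eta, Fin.mk_one, Fin.reduceFinMk,
      Matrix.cons_val_zero, Matrix.cons_val_one, Matrix.cons_val]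
    simp only [p1, p2, p3, p4, p5, p6, p7, e1, e2, e3, e4, e5, e6, e7, evalLine_pderiv, hd,
      div_eq_mul_inv,
      Polynomial.C_add, Polynomial.C_sub, Polynomial.C_neg, Polynomial.C_mul, Polynomial.C_1,
      Polynomial.C_0, Polynomial.C_ofNat, Polynomial.derivative_add, Polynomial.derivative_mul,
      Polynomial.derivative_neg,
      Polynomial.derivative_ofNat, Polynomial.derivative_zero, Polynomial.derivative_C,
      Polynomial.derivative_X, zero_mul, mul_zero, add_zero, zero_add,
      sub_zero, neg_zero, one_mul, mul_one]
    generalize evalLine 1 (pderiv 0 (pderiv 0 q0)) = c0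
    generalize evalLine 1 (pderiv 0 q0) = b0
    generalize evalLine 1 (pderiv 0 q1) = b1
    generalize evalLine 1 (pderiv 0 q2) = b2
    generalize evalLine 1 (pderiv 0 q3) = b3
    generalize evalLine 1 q0 = a0
    generalize evalLine 1 q1 = a1
    generalize evalLine 1 q2 = a2
    generalize evalLine 1 q3 = a3
    clear hχ z0 z1 z2 z3 d0 d1 d2 d3 e1 e2 e3 e4 e5 e6 e7 p1 p2 p3 p4 p5 p6 p7 hd x0 x1
    generalize Polynomial.C α⁻¹ = β at hαα ⊢
    generalize Polynomial.C α = γ at hαα ⊢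
    grind
end Projection

/-! ### The kernel of the projection is the ideal -/

section Kernel

open MvPolynomial

/-- A polynomial in `t` alone. -/
def lineLift (t : Fin 2) : Polynomial ℂ →ₐ[ℂ] MvPolynomial (Fin 2) ℂ := Polynomial.aeval (X t)

theorem exists_eq_lineLift_add {t s : Fin 2} (hts : t ≠ s) (q : MvPolynomial (Fin 2) ℂ) :
    ∃ r, q = lineLift t (evalLine t q) + X s * r := by
  induction q using MvPolynomial.induction_on with
  | C a => exact ⟨0, by simp [lineLift, evalLine, MvPolynomial.algebraMap_eq]⟩
  | add p q hp hq =>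
    obtain ⟨r, hr⟩ := hp
    obtain ⟨r', hr'⟩ := hq
    exact ⟨r + r', by rw [map_add, map_add, mul_add]; linear_combination hr + hr'⟩
  | mul_X p n hp =>
    obtain ⟨r, hr⟩ := hp
    by_cases hn : n = t
    · subst hn
      refine ⟨r * X n, ?_⟩
      have : lineLift n (evalLine n (X n)) = X n := by simp [lineLift, evalLine]
      rw [map_mul, map_mul, this]
      linear_combination X n * hr
    · have hns : n = s := by omega
      subst hns
      refine ⟨p, ?_⟩
      have : lineLift t (evalLine t (X n)) = 0 := by simp [lineLift, evalLine, hn]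
      rw [map_mul, map_mul, this]
      ring

theorem evalLine_X_self (t : Fin 2) : evalLine t (X t) = Polynomial.X := by simp [evalLine]

theorem evalLine_X_of_ne {t s : Fin 2} (hts : t ≠ s) : evalLine t (X s) = 0 := by
  simp [evalLine, hts.symm]

theorem pderiv_lineLift {t s : Fin 2} (hts : t ≠ s) (f : Polynomial ℂ) :
    pderiv s (lineLift t f) = 0 := by
  rw [lineLift, Derivation.map_aeval, pderiv_X_of_ne hts, smul_zero]

/-- The generators of the kernel of the projection onto the model. -/
def modelGens (κ : ℂ) (t s : Fin 2) : Set P :=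
  {(-κ) • ((X t * X s) ⊗ₜ 1) + 1 ⊗ₜ (extGen 0 * extGen 1), (X s ^ 2) ⊗ₜ 1, X s ⊗ₜ extGen 0,
    X s ⊗ₜ extGen 1}

theorem subalgebra_eq_top {S : Subalgebra ℂ P} (h : ∀ i, z i ∈ S) : S = ⊤ := by
  have hp : ∀ q : MvPolynomial (Fin 2) ℂ, q ⊗ₜ[ℂ] (1 : ExteriorAlgebra ℂ (Fin 2 → ℂ)) ∈ S := by
    intro q
    induction q using MvPolynomial.induction_on with
    | C a =>
      have : (C a : MvPolynomial (Fin 2) ℂ) ⊗ₜ[ℂ] (1 : ExteriorAlgebra ℂ (Fin 2 → ℂ))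
          = algebraMap ℂ P a := rfl
      rw [this]; exact S.algebraMap_mem a
    | add p q hp hq => rw [TensorProduct.add_tmul]; exact add_mem hp hq
    | mul_X p n hp =>
      have : (p * X n) ⊗ₜ[ℂ] (1 : ExteriorAlgebra ℂ (Fin 2 → ℂ)) = p ⊗ₜ 1 * X n ⊗ₜ 1 := by simp
      rw [this]
      refine mul_mem hp ?_
      fin_cases n
      · exact h 0
      · exact h 1
  refine eq_top_iff.2 fun p _ => ?_
  obtain ⟨q, rfl⟩ := exists_superPoly p
  have e : superPoly q = q 0 ⊗ₜ 1 + q 1 ⊗ₜ 1 * z 2 + q 2 ⊗ₜ 1 * z 3 + q 3 ⊗ₜ 1 * (z 2 * z 3) := by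
    simp [superPoly, z, extGen]
  rw [e]
  exact add_mem (add_mem (add_mem (hp _) (mul_mem (hp _) (h 2))) (mul_mem (hp _) (h 3)))
    (mul_mem (hp _) (mul_mem (h 2) (h 3)))

/-- The coordinates generate the superpolynomials, so stability under them makes the kernel a left
ideal. The delicate case is multiplication by `s`: the Leibniz rule produces `q 0` restricted to `s
= 0`, which is zero on the kernel. -/
theorem modelProj_z_mul (κ : ℂ) {t s : Fin 2} (hts : t ≠ s) (i : Fin 4) {p : P}
    (hp : modelProj κ t s p = 0) : modelProj κ t s (z i * p) = 0 := by
  obtain ⟨q, rfl⟩ := exists_superPoly p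
  rw [modelProj_superPoly] at hp
  have h0 : evalLine t (q 0) = 0 := congrFun hp 0
  have h1 : evalLine t (pderiv s (q 0)) + Polynomial.C κ * Polynomial.X * evalLine t (q 3) = 0 :=
    congrFun hp 1
  have h2 : evalLine t (q 1) = 0 := congrFun hp 2
  have h3 : evalLine t (q 2) = 0 := congrFun hp 3
  change modelProj κ t s (Z i (superPoly q)) = 0
  obtain ⟨z0, z1, z2, z3⟩ := Z_superPoly q
  have hX : ∀ n : Fin 2, modelProj κ t s
      (superPoly ![X n * q 0, X n * q 1, X n * q 2, X n * q 3]) = 0 := by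
    intro n
    rw [modelProj_superPoly]
    have : evalLine t (pderiv s (X n * q 0)) + Polynomial.C κ * Polynomial.X *
        evalLine t (X n * q 3) = 0 := by
      by_cases hn : n = t
      · subst hn
        rw [pderiv_mul, pderiv_X_of_ne hts, zero_mul, zero_add, map_mul, map_mul]
        linear_combination evalLine n (X n) * h1
      · have hns : n = s := by omega
        subst hns
        rw [pderiv_mul, pderiv_X_self, one_mul, map_add, map_mul, map_mul, evalLine_X_of_ne hts, h0]
        ring
    funext i
    fin_cases i
    · simp [h0]
    · exact this
    · simp [h2]
    · simp [h3]
  fin_cases i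
  · exact (congrArg _ z0).trans (hX 0)
  · exact (congrArg _ z1).trans (hX 1)
  · refine (congrArg _ z2).trans ?_
    rw [modelProj_superPoly]
    funext i
    fin_cases i <;> simp [h0, h3]
  · refine (congrArg _ z3).trans ?_
    rw [modelProj_superPoly]
    funext i
    fin_cases i <;> simp [h0, h2]

theorem modelProj_mul (κ : ℂ) {t s : Fin 2} (hts : t ≠ s) (a : P) {p : P}
    (hp : modelProj κ t s p = 0) : modelProj κ t s (a * p) = 0 := by
  let S : Subalgebra ℂ P :=
    { carrier := {a | ∀ p, modelProj κ t s p = 0 → modelProj κ t s (a * p) = 0}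
      mul_mem' := fun {a b} ha hb p hp => by rw [mul_assoc]; exact ha _ (hb p hp)
      add_mem' := fun {a b} ha hb p hp => by rw [add_mul, map_add, ha p hp, hb p hp, add_zero]
      algebraMap_mem' := fun r p hp => by
        rw [Algebra.algebraMap_eq_smul_one, smul_mul_assoc, one_mul, map_smul, hp, smul_zero] }
  have hS : S = ⊤ := subalgebra_eq_top fun i p hp => modelProj_z_mul κ hts i hp
  have ha : a ∈ S := hS ▸ Algebra.mem_top
  exact ha p hp

/-- The kernel of the projection onto the model is the left ideal generated by `modelGens`. -/
theorem mem_span_modelGens_iff (κ : ℂ) {t s : Fin 2} (hts : t ≠ s) (p : P) :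
    p ∈ Ideal.span (modelGens κ t s) ↔ modelProj κ t s p = 0 := by
  constructor
  · intro h
    refine Submodule.span_induction ?_ (map_zero _) ?_ ?_ h
    · rintro x (rfl | rfl | rfl | rfl)
      · have e : (-κ) • ((X t * X s) ⊗ₜ 1) + 1 ⊗ₜ (extGen 0 * extGen 1)
            = superPoly ![(-κ) • (X t * X s), 0, 0, 1] := by
          simp [superPoly, TensorProduct.smul_tmul', TensorProduct.neg_tmul]
        rw [e, modelProj_superPoly]
        funext i
        fin_cases i <;> simp [evalLine_X_of_ne hts, evalLine_X_self, pderiv_X_of_ne hts,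
          Polynomial.smul_eq_C_mul]
      · have e : (X s ^ 2 : MvPolynomial (Fin 2) ℂ) ⊗ₜ 1 = superPoly ![X s ^ 2, 0, 0, 0] := by
          simp [superPoly]
        rw [e, modelProj_superPoly]
        funext i
        fin_cases i <;> simp [evalLine_X_of_ne hts]
      · have e : (X s : MvPolynomial (Fin 2) ℂ) ⊗ₜ extGen 0 = superPoly ![0, X s, 0, 0] := by
          simp [superPoly]
        rw [e, modelProj_superPoly]
        funext i
        fin_cases i <;> simp [evalLine_X_of_ne hts]
      · have e : (X s : MvPolynomial (Fin 2) ℂ) ⊗ₜ extGen 1 = superPoly ![0, 0, X s, 0] := by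
          simp [superPoly]
        rw [e, modelProj_superPoly]
        funext i
        fin_cases i <;> simp [evalLine_X_of_ne hts]
    · intro x y _ _ hx hy
      rw [map_add, hx, hy, add_zero]
    · intro a x _ hx
      exact modelProj_mul κ hts a hx
  · intro hp
    obtain ⟨q, rfl⟩ := exists_superPoly p
    rw [modelProj_superPoly] at hp
    have h0 : evalLine t (q 0) = 0 := congrFun hp 0
    have h1 : evalLine t (pderiv s (q 0)) + Polynomial.C κ * Polynomial.X * evalLine t (q 3) = 0 :=
      congrFun hp 1
    have h2 : evalLine t (q 1) = 0 := congrFun hp 2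
    have h3 : evalLine t (q 2) = 0 := congrFun hp 3
    obtain ⟨r, hr⟩ := exists_eq_lineLift_add hts (q 0)
    obtain ⟨r0, hr0⟩ := exists_eq_lineLift_add hts r
    obtain ⟨r1, hr1⟩ := exists_eq_lineLift_add hts (q 1)
    obtain ⟨r2, hr2⟩ := exists_eq_lineLift_add hts (q 2)
    obtain ⟨r3, hr3⟩ := exists_eq_lineLift_add hts (q 3)
    -- On the kernel `q 0`, `q 1` and `q 2` are divisible by `s`. The linear coefficient of `q 0` in
    -- `s` is forced to be `-κ t m`, so it pairs with the leading part `m` of `q 3` to give a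
    -- multiple of the first generator. The rest is divisible by `s²`, `s z₃` or `s z₄`.
    set m := lineLift t (evalLine t (q 3)) with hm
    have hd : evalLine t (pderiv s (q 0)) = evalLine t r := by
      rw [hr, map_add, pderiv_lineLift hts, pderiv_mul, pderiv_X_self, zero_add, one_mul, map_add,
        map_mul, evalLine_X_of_ne hts, zero_mul, add_zero]
    have hr' : lineLift t (evalLine t r) = (-κ) • (X t * m) := by
      have : evalLine t r = (-κ) • (Polynomial.X * evalLine t (q 3)) := by
        rw [← hd, Polynomial.smul_eq_C_mul, Polynomial.C_neg]
        linear_combination h1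
      rw [this, map_smul, map_mul, hm]
      congr 2
      simp [lineLift]
    rw [h0, map_zero, zero_add] at hr
    rw [h2, map_zero, zero_add] at hr1
    rw [h3, map_zero, zero_add] at hr2
    rw [hr'] at hr0
    have e : superPoly q =
        (m ⊗ₜ 1) * ((-κ) • ((X t * X s) ⊗ₜ 1) + 1 ⊗ₜ (extGen 0 * extGen 1))
          + (r0 ⊗ₜ 1) * ((X s ^ 2) ⊗ₜ 1) + (r1 ⊗ₜ 1) * (X s ⊗ₜ extGen 0)
          + (r2 ⊗ₜ 1) * (X s ⊗ₜ extGen 1) + (r3 ⊗ₜ extGen 0) * (X s ⊗ₜ extGen 1) := by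
      have e0 : q 0 = (-κ) • (m * (X t * X s)) + r0 * X s ^ 2 := by
        rw [hr, hr0]
        simp only [smul_eq_C_mul]
        ring
      have e3 : q 3 = m + r3 * X s := by rw [hr3, mul_comm]
      simp only [superPoly, e0, hr1, hr2, e3, mul_add, mul_smul_comm,
        Algebra.TensorProduct.tmul_mul_tmul, mul_one, one_mul, TensorProduct.add_tmul,
        TensorProduct.smul_tmul', mul_comm r1, mul_comm r2]
      abel
    rw [e]
    have hg : ∀ g ∈ modelGens κ t s, ∀ a : P, a * g ∈ Ideal.span (modelGens κ t s) :=
      fun g hg a => Ideal.mul_mem_left _ a (Ideal.subset_span hg)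
    refine add_mem (add_mem (add_mem (add_mem ?_ ?_) ?_) ?_) ?_ <;> refine hg _ ?_ _ <;>
      simp [modelGens]

theorem idealGens_eq (α : ℂ) : idealGens α α = modelGens (-2) 0 1 := by
  rw [idealGens, if_pos rfl, modelGens]
  have e : (2 : P) = (2 : ℂ) • 1 := by
    rw [← Algebra.algebraMap_eq_smul_one, map_ofNat]
  congr 1
  · simp [z, e, extGen, TensorProduct.smul_tmul']
  · simp [z, extGen, Algebra.TensorProduct.tmul_pow]

theorem idealGens_eq_swap {α : ℂ} (hα : α ≠ 1) : idealGens α 1 = modelGens (-2 * α) 1 0 := by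
  rw [idealGens, if_neg hα.symm, modelGens]
  congr 1
  · simp [z, extGen, TensorProduct.smul_tmul', mul_comm]
  · simp [z, extGen, Algebra.TensorProduct.tmul_pow]

end Kernel

/-! ### The action of the enveloping algebra on the Fock space -/

section Action

/-- `Q` identifies the Fock space with its image in the model. -/
structure IsModel (α lam ν κ : ℂ) (t s : Fin 4) (Q : P →ₗ[ℂ] FockModel) : Prop where
  params : ModelParams α ν κ t s
  map_one : Q 1 = modelVac
  map_piRep : ∀ X p, Q (piRep α lam X p) = modelRep ν κ t s X (Q p)
  mem_ideal : ∀ p, p ∈ fockIdeal α lam ↔ Q p = 0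

theorem modelProj_one (κ : ℂ) (t s : Fin 2) : modelProj κ t s 1 = modelVac := by
  have e : (1 : P) = superPoly ![1, 0, 0, 0] := by
    simp [superPoly, Algebra.TensorProduct.one_def]
  rw [e, modelProj_superPoly]
  funext i
  fin_cases i <;> simp [modelVac]

theorem exists_isModel {α lam : ℂ} (hα : α ≠ 0)
    (h : (lam = α ∧ ∀ n : ℕ, α ≠ n) ∨ (lam = 1 ∧ ∀ n : ℕ, α⁻¹ ≠ n)) :
    ∃ ν κ t s Q, IsModel α lam ν κ t s Q := by
  rcases h with ⟨rfl, -⟩ | ⟨rfl, h⟩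
  · refine ⟨lam, -2, 0, 1, modelProj (-2) 0 1, Or.inl ⟨rfl, rfl, rfl, rfl⟩, modelProj_one _ _ _,
      modelProj_piRep hα, fun p => ?_⟩
    rw [fockIdeal, Submodule.restrictScalars_mem, idealGens_eq]
    exact mem_span_modelGens_iff _ (by decide) p
  · have h1 : α ≠ 1 := fun h1 => h 1 (by simp [h1])
    refine ⟨α⁻¹, -2 * α, 1, 0, modelProj (-2 * α) 1 0, Or.inr ⟨hα, rfl, rfl, rfl, rfl⟩,
      modelProj_one _ _ _, modelProj_piRep_swap hα, fun p => ?_⟩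
    rw [fockIdeal, Submodule.restrictScalars_mem, idealGens_eq_swap h1]
    exact mem_span_modelGens_iff _ (by decide) p

namespace IsModel

variable {α lam ν κ : ℂ} {t s : Fin 4} {Q : P →ₗ[ℂ] FockModel}

/-- The embedding of the Fock space into the model. -/
def proj (h : IsModel α lam ν κ t s Q) : Fock α lam →ₗ[ℂ] FockModel :=
  (fockIdeal α lam).liftQ Q fun p hp => (h.mem_ideal p).1 hp

theorem proj_mk (h : IsModel α lam ν κ t s Q) (p : P) :
    h.proj ((fockIdeal α lam).mkQ p) = Q p := Submodule.liftQ_apply _ _ _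

theorem proj_injective (h : IsModel α lam ν κ t s Q) : Function.Injective h.proj := by
  rw [← LinearMap.ker_eq_bot]
  exact Submodule.ker_liftQ_eq_bot _ _ _ fun p hp => (h.mem_ideal p).2 hp

theorem map_rho (h : IsModel α lam ν κ t s Q) (X : G α) (p : P) :
    Q (rho α lam X p) = modelRep ν κ t s (cayley α X) (Q p) := h.map_piRep _ p

/-- The operator on the Fock space induced by the Fock representation. -/
def op (h : IsModel α lam ν κ t s Q) (X : G α) : Module.End ℂ (Fock α lam) :=
  (fockIdeal α lam).mapQ (fockIdeal α lam) (rho α lam X) fun p hp => by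
    rw [Submodule.mem_comap, h.mem_ideal, h.map_rho, (h.mem_ideal p).1 hp, map_zero]

theorem op_mk (h : IsModel α lam ν κ t s Q) (X : G α) (p : P) :
    h.op X ((fockIdeal α lam).mkQ p) = (fockIdeal α lam).mkQ (rho α lam X p) := rfl

/-- As `proj` is injective, linearity in `X` and the supercommutation relations on the Fock space
can be read off in the model. -/
theorem proj_op (h : IsModel α lam ν κ t s Q) (X : G α) (v : Fock α lam) :
    h.proj (h.op X v) = modelRepₗ ν κ t s α (cayley α X) (h.proj v) := by
  obtain ⟨p, rfl⟩ := (fockIdeal α lam).mkQ_surjective v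
  rw [op_mk, proj_mk, proj_mk, h.map_rho]
  rfl

/-- The Fock representation on the Fock space as a linear map. -/
def rep (h : IsModel α lam ν κ t s Q) : G α →ₗ[ℂ] Module.End ℂ (Fock α lam) where
  toFun := h.op
  map_add' X Y := LinearMap.ext fun v => h.proj_injective <| by
    simp only [proj_op, map_add, LinearMap.add_apply]
  map_smul' c X := LinearMap.ext fun v => h.proj_injective <| by
    simp only [proj_op, map_smul, LinearMap.smul_apply, RingHom.id_apply]

theorem rep_comm (h : IsModel α lam ν κ t s Q) {i j : Fin 2} {X Y : G α} (hX : IsHomog i X)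
    (hY : IsHomog j Y) :
    h.rep X * h.rep Y = (-1 : ℂ) ^ ((i : ℕ) * (j : ℕ)) • (h.rep Y * h.rep X)
      + h.rep (bracket α X Y) := by
  refine LinearMap.ext fun v => h.proj_injective ?_
  have := LinearMap.congr_fun (modelRep_comm h.params (cayley_homog hX) (cayley_homog hY))
    (h.proj v)
  -- The model relation was applied to the Cayley transforms of `X` and `Y`; the automorphism
  -- property brings their bracket back to that of `X` and `Y`.
  rw [← cayley_bracket] at this
  simp only [LinearMap.add_apply, LinearMap.smul_apply, Module.End.mul_apply, map_add, map_smul]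
    at this ⊢
  change h.proj (h.op X (h.op Y v))
    = _ • h.proj (h.op Y (h.op X v)) + h.proj (h.op (bracket α X Y) v)
  rw [proj_op, proj_op, proj_op, proj_op, proj_op]
  exact this

/-- The action of the universal enveloping algebra on the Fock space. -/
def action (h : IsModel α lam ν κ t s Q) : UE α →ₐ[ℂ] Module.End ℂ (Fock α lam) :=
  RingQuot.liftAlgHom ℂ ⟨TensorAlgebra.lift ℂ h.rep, by
    rintro _ _ ⟨i, j, X, Y, hX, hY⟩
    simp only [map_add, map_mul, map_smul, TensorAlgebra.lift_ι_apply]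
    exact h.rep_comm hX hY⟩

theorem isFockAction (h : IsModel α lam ν κ t s Q) : IsFockAction α lam h.action := by
  intro X p
  have : h.action (ueι α X) = h.rep X := by
    simp [action, ueι]
  rw [this]
  rfl

end IsModel

/-- An algebra homomorphism on `U(𝔤)` is determined on `𝔤`, and there the action is prescribed on
the classes of all superpolynomials. -/
theorem IsFockAction.unique {α lam : ℂ} {Φ Ψ : UE α →ₐ[ℂ] Module.End ℂ (Fock α lam)}
    (hΦ : IsFockAction α lam Φ) (hΨ : IsFockAction α lam Ψ) : Ψ = Φ := by
  refine RingQuot.ringQuot_ext' ℂ _ _ (TensorAlgebra.hom_ext (LinearMap.ext fun X => ?_))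
  refine LinearMap.ext fun v => ?_
  obtain ⟨p, rfl⟩ := (fockIdeal α lam).mkQ_surjective v
  exact (hΨ X p).trans (hΦ X p).symm

theorem IsModel.proj_action {α lam ν κ : ℂ} {t s : Fin 4} {Q : P →ₗ[ℂ] FockModel}
    (h : IsModel α lam ν κ t s Q) {Φ : UE α →ₐ[ℂ] Module.End ℂ (Fock α lam)}
    (hΦ : IsFockAction α lam Φ) (X : G α) (v : Fock α lam) :
    h.proj (Φ (ueι α X) v) = modelRepₗ ν κ t s α (cayley α X) (h.proj v) := by
  obtain ⟨p, rfl⟩ := (fockIdeal α lam).mkQ_surjective v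
  rw [hΦ, ← h.op_mk, h.proj_op]

end Action

/-! ### The degree filtration of the model -/

section Filtration

open Polynomial

/-- The filtration of the model by degree. -/
def modelFil (k : ℕ) : Submodule ℂ FockModel :=
  -- Total degree at most `k`: the basis vectors `s, z₃, z₄` have degree one themselves, so their
  -- coefficients have degree less than `k`.
  Submodule.pi Set.univ fun i => degreeLT ℂ (if i = 0 then k + 1 else k)

theorem mem_modelFil {k : ℕ} {n : FockModel} :
    n ∈ modelFil k ↔ n 0 ∈ degreeLT ℂ (k + 1) ∧ n 1 ∈ degreeLT ℂ k ∧ n 2 ∈ degreeLT ℂ k ∧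
      n 3 ∈ degreeLT ℂ k := by
  simp [modelFil, Submodule.mem_pi, Fin.forall_fin_succ]

/-- The degree filtration as a product. -/
def modelFilEquiv (k : ℕ) :
    modelFil k ≃ₗ[ℂ] ((i : Fin 4) → (Fin (if i = 0 then k + 1 else k) → ℂ)) :=
  LinearEquiv.trans
    { toFun := fun x i => ⟨x.1 i, x.2 i trivial⟩
      invFun := fun x => ⟨fun i => x i, fun i _ => (x i).2⟩
      map_add' := fun _ _ => rfl
      map_smul' := fun _ _ => rfl
      left_inv := fun _ => rfl
      right_inv := fun _ => rfl :
        modelFil k ≃ₗ[ℂ] ((i : Fin 4) → degreeLT ℂ (if i = 0 then k + 1 else k)) }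
    (LinearEquiv.piCongrRight fun i => degreeLTEquiv ℂ (if i = 0 then k + 1 else k))

theorem finrank_modelFil (k : ℕ) : Module.finrank ℂ (modelFil k) = 1 + 4 * k := by
  rw [(modelFilEquiv k).finrank_eq, Module.finrank_pi_fintype]
  simp [Fin.sum_univ_four]
  ring

theorem modelFil_mono (k : ℕ) : modelFil k ≤ modelFil (k + 1) := by
  intro n hn
  rw [mem_modelFil] at hn ⊢
  have h := fun m => degreeLT_mono (R := ℂ) (Nat.le_succ m)
  exact ⟨h _ hn.1, h _ hn.2.1, h _ hn.2.2.1, h _ hn.2.2.2⟩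

theorem C_mul_mem_degreeLT {m : ℕ} {f : ℂ[X]} (a : ℂ) (hf : f ∈ degreeLT ℂ m) :
    C a * f ∈ degreeLT ℂ m := by
  rw [← smul_eq_C_mul]; exact Submodule.smul_mem _ _ hf

theorem X_mul_mem_degreeLT {m : ℕ} {f : ℂ[X]} (hf : f ∈ degreeLT ℂ m) :
    X * f ∈ degreeLT ℂ (m + 1) := by
  rw [mem_degreeLT] at hf ⊢
  by_cases h0 : f = 0
  · simp only [h0, mul_zero, degree_zero]; exact WithBot.bot_lt_coe _
  · rw [degree_mul, degree_X, degree_eq_natDegree h0] at *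
    norm_cast at *
    omega

theorem C_mul_X_mul_mem_degreeLT {m : ℕ} {f : ℂ[X]} (a : ℂ) (hf : f ∈ degreeLT ℂ m) :
    C a * X * f ∈ degreeLT ℂ (m + 1) := by
  rw [mul_assoc]; exact C_mul_mem_degreeLT a (X_mul_mem_degreeLT hf)

theorem derivative_mem_degreeLT {m : ℕ} {f : ℂ[X]} (hf : f ∈ degreeLT ℂ m) :
    derivative f ∈ degreeLT ℂ m := by
  rw [mem_degreeLT] at hf ⊢
  exact degree_derivative_le.trans_lt hf

theorem vec_mem_modelFil {k : ℕ} {a b c d : ℂ[X]} (ha : a ∈ degreeLT ℂ (k + 1))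
    (hb : b ∈ degreeLT ℂ k) (hc : c ∈ degreeLT ℂ k) (hd : d ∈ degreeLT ℂ k) :
    (![a, b, c, d] : FockModel) ∈ modelFil k := mem_modelFil.2 ⟨ha, hb, hc, hd⟩

/-- Every term contains at most one factor `t`. It suffices that derivatives do not raise the
degree; the drop they cause is not needed. -/
theorem evenOp_mem_modelFil (ν u0 u1 m00 m11 m22 m23 m32 x0 x1 : ℂ) {k : ℕ} {n : FockModel}
    (hn : n ∈ modelFil k) :
    evenOp ν u0 u1 m00 m11 m22 m23 m32 x0 x1 n ∈ modelFil (k + 1) := by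
  obtain ⟨h0, h1, h2, h3⟩ := mem_modelFil.1 hn
  have h := fun m => degreeLT_mono (R := ℂ) (Nat.le_succ m)
  have g0 := h _ h0
  have g1 := h _ h1
  have g2 := h _ h2
  have g3 := h _ h3
  -- The term `-x1 n 1` lands in the component along `1`, whose bound is `k + 2`, two above that of
  -- `n 1`.
  have g1' := h _ g1
  refine vec_mem_modelFil ?_ ?_ ?_ ?_
  all_goals
    repeat' with_reducible first
      | assumption
      | apply Submodule.add_mem
      | apply Submodule.sub_mem
      | apply C_mul_X_mul_mem_degreeLT
      | apply C_mul_mem_degreeLT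
      | apply X_mul_mem_degreeLT
      | apply derivative_mem_degreeLT

theorem oddOp_mem_modelFil (ν κ u2 u3 m20 m21 m30 m31 x2 x3 : ℂ) {k : ℕ} {n : FockModel}
    (hn : n ∈ modelFil k) :
    oddOp ν κ u2 u3 m20 m21 m30 m31 x2 x3 n ∈ modelFil (k + 1) := by
  obtain ⟨h0, h1, h2, h3⟩ := mem_modelFil.1 hn
  have h := fun m => degreeLT_mono (R := ℂ) (Nat.le_succ m)
  have g1 := h _ h1
  have g2 := h _ h2
  have g3 := h _ h3
  have g2' := h _ g2
  have g3' := h _ g3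
  refine vec_mem_modelFil ?_ ?_ ?_ ?_
  all_goals
    repeat' with_reducible first
      | assumption
      | apply Submodule.add_mem
      | apply Submodule.sub_mem
      | apply C_mul_X_mul_mem_degreeLT
      | apply C_mul_mem_degreeLT
      | apply X_mul_mem_degreeLT
      | apply derivative_mem_degreeLT

theorem modelRep_mem_modelFil (ν κ : ℂ) (t s : Fin 4) {α : ℂ} (X : G α) {k : ℕ} {n : FockModel}
    (hn : n ∈ modelFil k) : modelRep ν κ t s X n ∈ modelFil (k + 1) :=
  Submodule.add_mem _ (evenOp_mem_modelFil _ _ _ _ _ _ _ _ _ _ hn)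
    (oddOp_mem_modelFil _ _ _ _ _ _ _ _ _ _ hn)

theorem modelVac_mem_modelFil (k : ℕ) : modelVac ∈ modelFil k := by
  refine vec_mem_modelFil ?_ (zero_mem _) (zero_mem _) (zero_mem _)
  rw [mem_degreeLT, degree_one]
  norm_cast
  omega

theorem divX_mem_degreeLT {m : ℕ} {f : ℂ[X]} (hf : f ∈ degreeLT ℂ (m + 1)) :
    divX f ∈ degreeLT ℂ m := by
  rw [degreeLT, Submodule.mem_iInf] at hf ⊢
  intro i
  rw [Submodule.mem_iInf]
  intro hi
  have := hf (i + 1)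
  rw [Submodule.mem_iInf] at this
  rw [LinearMap.mem_ker, lcoeff_apply, coeff_divX]
  exact this (by omega)

theorem modelRep_fst (ν κ : ℂ) (t s : Fin 4) {α : ℂ} (u : J) (n : FockModel) :
    modelRep ν κ t s ((u, 0, 0) : G α) n =
      ![C (-2 * Complex.I * u t) * X * n 0,
        C (-2 * Complex.I * u t) * X * n 1 + C (-2 * Complex.I * u s) * n 0
          + (C (κ * (-2 * Complex.I * u 2)) * X * n 3 - C (κ * (-2 * Complex.I * u 3)) * X * n 2),
        C (-2 * Complex.I * u t) * X * n 2 + C (-2 * Complex.I * u 2) * n 0,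
        C (-2 * Complex.I * u t) * X * n 3 + C (-2 * Complex.I * u 3) * n 0] := by
  funext i
  fin_cases i <;>
  simp [modelRep, evenOp, oddOp, minusAct_zero, -map_mul, -map_neg, -neg_mul]

/-- Each filtration step is reached from the previous one by the action of `D_α⁻`. -/
theorem mem_of_mem_modelFil_succ {α ν κ : ℂ} {t s : Fin 4} (hts : ModelParams α ν κ t s)
    {k : ℕ} {W : Submodule ℂ FockModel} (hW : ∀ X : G α, ∀ n ∈ modelFil k,
      modelRep ν κ t s X n ∈ W) (hW' : modelFil k ≤ W) : modelFil (k + 1) ≤ W := by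
  intro n hn
  obtain ⟨h0, h1, h2, h3⟩ := mem_modelFil.1 hn
  have ht : (t ≠ s) ∧ t ≠ 2 ∧ t ≠ 3 ∧ s ≠ 2 ∧ s ≠ 3 := by
    rcases hts with ⟨-, -, rfl, rfl⟩ | ⟨-, -, -, rfl, rfl⟩ <;> decide
  obtain ⟨n1, n2, n3, n4, n5⟩ := ht
  have hC : (C 2 * C Complex.I * C (Complex.I / 2) : ℂ[X]) = -1 := by
    rw [← C_mul, ← C_mul, ← C_1, ← C_neg]
    congr 1
    linear_combination Complex.I_mul_I
  have hv := modelVac_mem_modelFil k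
  -- The factor `i/2` compensates `-2i`, so `Y i` acts as multiplication by the coordinate `zᵢ`.
  let Y : Fin 4 → G α := fun i => ((Complex.I / 2) • Pi.single i 1, 0, 0)
  -- Split off the constant terms of the four components: the rest is `t` times an element of the
  -- previous step, and the constants give multiples of `1, s, z₃, z₄`, which are coordinates
  -- applied to the vacuum or the vacuum itself.
  have key : n = (n 0).coeff 0 • modelVac
      + modelRep ν κ t s (Y t) ![divX (n 0), divX (n 1), divX (n 2), divX (n 3)]
      + (n 1).coeff 0 • modelRep ν κ t s (Y s) modelVac
      + (n 2).coeff 0 • modelRep ν κ t s (Y 2) modelVac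
      + (n 3).coeff 0 • modelRep ν κ t s (Y 3) modelVac := by
    simp only [Y, modelRep_fst]
    funext i
    fin_cases i <;>
    simp [modelVac, n1, n2, n3, n4, n5, n1.symm, n2.symm, n3.symm, n4.symm,
      n5.symm, smul_eq_C_mul]
    · linear_combination -divX_mul_X_add (n 0) + X * divX (n 0) * hC
    · linear_combination -divX_mul_X_add (n 1) + (X * divX (n 1) + C ((n 1).coeff 0)) * hC
    · linear_combination -divX_mul_X_add (n 2) + (X * divX (n 2) + C ((n 2).coeff 0)) * hC
    · linear_combination -divX_mul_X_add (n 3) + (X * divX (n 3) + C ((n 3).coeff 0)) * hC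
  rw [key]
  have hd : (![divX (n 0), divX (n 1), divX (n 2), divX (n 3)] : FockModel) ∈ modelFil k :=
    vec_mem_modelFil (divX_mem_degreeLT h0) (divX_mem_degreeLT h1) (divX_mem_degreeLT h2)
      (divX_mem_degreeLT h3)
  exact add_mem (add_mem (add_mem (add_mem (W.smul_mem _ (hW' hv)) (hW _ _ hd))
    (W.smul_mem _ (hW _ _ hv))) (W.smul_mem _ (hW _ _ hv))) (W.smul_mem _ (hW _ _ hv))

end Filtration

/-! ### Growth exponents of finitely generated modules -/

section GelfandKirillov

open Filter

theorem exists_le_of_fg {M : Type*} [AddCommGroup M] [Module ℂ M] {S : ℕ → Submodule ℂ M}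
    (hS : Monotone S) (h : ∀ x, ∃ k, x ∈ S k) {N : Submodule ℂ M} (hN : N.FG) :
    ∃ k, N ≤ S k := by
  induction N, hN using Submodule.fg_induction with
  | singleton x =>
    obtain ⟨k, hk⟩ := h x
    exact ⟨k, by rwa [Submodule.span_singleton_le_iff_mem]⟩
  | sup A B _ _ hA hB =>
    obtain ⟨a, ha⟩ := hA
    obtain ⟨b, hb⟩ := hB
    exact ⟨max a b, sup_le (ha.trans (hS (le_max_left _ _))) (hb.trans (hS (le_max_right _ _)))⟩

variable {R M : Type*} [Ring R] [Algebra ℂ R] [AddCommGroup M] [Module ℂ M] [Module R M]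
  [IsScalarTower ℂ R M] {V W : Submodule ℂ R} {N F₀ : Submodule ℂ M}

theorem pow_mono_of_one_mem (hV : (1 : R) ∈ V) : Monotone fun k : ℕ => V ^ k :=
  monotone_nat_of_le_succ fun k => by
    rw [pow_succ]
    intro x hx
    simpa using Submodule.mul_mem_mul hx hV

theorem exists_mem_pow (hV : (1 : R) ∈ V) (h : Algebra.adjoin ℂ (V : Set R) = ⊤) (x : R) :
    ∃ k : ℕ, x ∈ V ^ k := by
  have hx : x ∈ Algebra.adjoin ℂ (V : Set R) := h ▸ Algebra.mem_top
  induction hx using Algebra.adjoin_induction with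
  | mem x hx => exact ⟨1, by simpa using hx⟩
  | algebraMap r => exact ⟨0, by rw [pow_zero]; exact Submodule.algebraMap_mem r⟩
  | add x y _ _ hx hy =>
    obtain ⟨a, ha⟩ := hx
    obtain ⟨b, hb⟩ := hy
    exact ⟨max a b, add_mem (pow_mono_of_one_mem hV (le_max_left _ _) ha)
      (pow_mono_of_one_mem hV (le_max_right _ _) hb)⟩
  | mul x y _ _ hx hy =>
    obtain ⟨a, ha⟩ := hx
    obtain ⟨b, hb⟩ := hy
    exact ⟨a + b, by rw [pow_add]; exact Submodule.mul_mem_mul ha hb⟩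

theorem pow_smul_mono (hV : (1 : R) ∈ V) (N : Submodule ℂ M) :
    Monotone fun k : ℕ => V ^ k • N :=
  fun _ _ h => Submodule.smul_mono_left (pow_mono_of_one_mem hV h)

theorem exists_mem_pow_smul (h : IsGKPair V N) (x : M) : ∃ k : ℕ, x ∈ V ^ k • N := by
  have hx : x ∈ Submodule.span R (N : Set M) := h.span_eq_top ▸ Submodule.mem_top
  induction hx using Submodule.span_induction with
  | mem x hx =>
    exact ⟨0, by simpa using Submodule.smul_mem_smul (Submodule.one_le.1 (pow_zero V).ge) hx⟩
  | zero => exact ⟨0, zero_mem _⟩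
  | add x y _ _ hx hy =>
    obtain ⟨a, ha⟩ := hx
    obtain ⟨b, hb⟩ := hy
    exact ⟨max a b, add_mem (pow_smul_mono h.one_mem N (le_max_left _ _) ha)
      (pow_smul_mono h.one_mem N (le_max_right _ _) hb)⟩
  | smul r x _ hx =>
    obtain ⟨a, ha⟩ := exists_mem_pow h.one_mem h.adjoin_eq_top r
    obtain ⟨b, hb⟩ := hx
    exact ⟨a + b, by
      rw [pow_add, ← smul_eq_mul, Submodule.smul_assoc]
      exact Submodule.smul_mem_smul ha hb⟩

/-- The product is the image of `V` and `N` under the bilinear action map, so products of generators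
span it. -/
theorem fg_smul (hV : V.FG) (hN : N.FG) : (V • N).FG := by
  have : V • N = Submodule.map₂ (Algebra.lsmul ℂ ℂ M : R →ₐ[ℂ] _).toLinearMap V N :=
    le_antisymm (Submodule.smul_le.2 fun r hr n hn => Submodule.apply_mem_map₂ _ hr hn)
      (Submodule.map₂_le.2 fun r hr n hn => Submodule.smul_mem_smul hr hn)
  rw [this]
  exact Submodule.FG.map₂ _ hV hN

theorem fg_pow_smul (h : IsGKPair V N) (k : ℕ) : (V ^ k • N).FG :=
  fg_smul ((Module.Finite.iff_fg.1 h.finite_left).pow k) (Module.Finite.iff_fg.1 h.finite_right)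

/-- A linear bound on the dimensions of the filtration bounds the growth by one. -/
theorem gkGrowth_le_one (C : ℕ)
    (h : ∀ k : ℕ, Module.finrank ℂ (V ^ k • N : Submodule ℂ M) ≤ C * (k + 1)) :
    gkGrowth V N ≤ 1 := by
  -- This is `log_k ((2C + 1) k)`. The bound `C (k + 1) ≤ (2C + 1) k` holds for `k ≥ 1`, and the
  -- extra 1 keeps the argument of the logarithm positive when `C = 0`.
  have hlim : Tendsto (fun k : ℕ => ((Real.log (2 * C + 1) / Real.log k + 1 : ℝ) : EReal)) atTop
      (nhds ((0 + 1 : ℝ) : EReal)) :=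
    (continuous_coe_real_ereal.tendsto _).comp (((Real.tendsto_log_atTop.comp
      tendsto_natCast_atTop_atTop).const_div_atTop _).add_const 1)
  rw [zero_add, EReal.coe_one] at hlim
  rw [← hlim.limsup_eq]
  refine limsup_le_limsup ?_
  filter_upwards [eventually_ge_atTop 2] with k hk
  have hk' : (2 : ℝ) ≤ k := by exact_mod_cast hk
  have hlog : 0 < Real.log k := Real.log_pos (by linarith)
  have hC : (0 : ℝ) ≤ C := Nat.cast_nonneg C
  refine EReal.coe_le_coe_iff.2 ?_
  have hd : (Module.finrank ℂ (V ^ k • N : Submodule ℂ M) : ℝ) ≤ (2 * C + 1) * k := by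
    have : (Module.finrank ℂ (V ^ k • N : Submodule ℂ M) : ℝ) ≤ C * (k + 1) := by
      exact_mod_cast h k
    nlinarith
  rw [Real.logb, div_add_one hlog.ne', ← Real.log_mul (by positivity) (by positivity)]
  refine div_le_div_of_nonneg_right ?_ hlog.le
  rcases Nat.eq_zero_or_pos (Module.finrank ℂ (V ^ k • N : Submodule ℂ M)) with h0 | h0
  -- For dimension zero the logarithm takes its default value 0, which still lies below the bound.
  · rw [h0, Nat.cast_zero, Real.log_zero]
    exact Real.log_nonneg (by nlinarith)
  · exact Real.log_le_log (by exact_mod_cast h0) hd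

theorem gkGrowth_le_one_of_filtration (hW : (1 : R) ∈ W) (hW' : Algebra.adjoin ℂ (W : Set R) = ⊤)
    (hN : ∀ x, ∃ k : ℕ, x ∈ W ^ k • N) (hfin : ∀ k : ℕ, (W ^ k • N).FG) (C : ℕ)
    (hC : ∀ k : ℕ, Module.finrank ℂ (W ^ k • N : Submodule ℂ M) ≤ C * (k + 1))
    (h : IsGKPair V F₀) : gkGrowth V F₀ ≤ 1 := by
  obtain ⟨m, hm⟩ := exists_le_of_fg (pow_mono_of_one_mem hW) (exists_mem_pow hW hW')
    (Module.Finite.iff_fg.1 h.finite_left)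
  obtain ⟨p, hp⟩ := exists_le_of_fg (pow_smul_mono hW N) hN (Module.Finite.iff_fg.1 h.finite_right)
  -- With `V ≤ W^m` and `F₀ ≤ W^p N` one gets `V^k F₀ ≤ W^(mk + p) N`, and `mk + p + 1 ≤ (m + p +
  -- 1)(k + 1)`.
  refine gkGrowth_le_one (C * (m + p + 1)) fun k => ?_
  have hle : V ^ k • F₀ ≤ W ^ (m * k + p) • N := by
    rw [pow_add, ← smul_eq_mul, Submodule.smul_assoc, pow_mul]
    exact Submodule.smul_mono (pow_le_pow_left' hm k) hp
  have := Module.Finite.iff_fg.2 (hfin (m * k + p))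
  calc _ ≤ Module.finrank ℂ (W ^ (m * k + p) • N : Submodule ℂ M) :=
        Submodule.finrank_mono hle
    _ ≤ C * (m * k + p + 1) := hC _
    _ ≤ C * (m + p + 1) * (k + 1) := by
      rw [mul_assoc]
      exact Nat.mul_le_mul_left _ (by nlinarith)

/-- If two consecutive steps agree, multiplication by `V` fixes that step, so the chain is constant
from there on. Its union is the whole module, which would then be finite-dimensional. -/
theorem pow_smul_lt (hM : ¬ FiniteDimensional ℂ M) (h : IsGKPair V N) (k : ℕ) :
    V ^ k • N < V ^ (k + 1) • N := by
  refine lt_of_le_of_ne (pow_smul_mono h.one_mem N k.le_succ) fun heq => hM ?_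
  have hstep : V • (V ^ k • N) = V ^ k • N := by
    rw [← Submodule.smul_assoc, smul_eq_mul, ← pow_succ', ← heq]
  have hall : ∀ l : ℕ, V ^ (l + k) • N = V ^ k • N := by
    intro l
    induction l with
    | zero => rw [zero_add]
    | succ l ih =>
      rw [Nat.succ_add, pow_succ', ← smul_eq_mul, Submodule.smul_assoc, ih, hstep]
  have htop : V ^ k • N = ⊤ := by
    rw [eq_top_iff]
    intro x _
    obtain ⟨l, hl⟩ := exists_mem_pow_smul h x
    rw [← hall l]
    exact pow_smul_mono h.one_mem N (Nat.le_add_right l k) hl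
  exact Module.Finite.iff_fg.2 (htop ▸ fg_pow_smul h k) |>.equiv Submodule.topEquiv

theorem le_finrank_pow_smul (hM : ¬ FiniteDimensional ℂ M) (h : IsGKPair V N) (k : ℕ) :
    k ≤ Module.finrank ℂ (V ^ k • N : Submodule ℂ M) := by
  induction k with
  | zero => exact Nat.zero_le _
  | succ k ih =>
    have := Module.Finite.iff_fg.2 (fg_pow_smul h (k + 1))
    exact ih.trans_lt (Submodule.finrank_lt_finrank_of_lt (pow_smul_lt hM h k))

/-- The growth of an infinite-dimensional module is at least one. -/
theorem one_le_gkGrowth (hM : ¬ FiniteDimensional ℂ M) (h : IsGKPair V N) :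
    1 ≤ gkGrowth V N := by
  refine le_limsup_of_frequently_le (Eventually.frequently ?_)
  filter_upwards [eventually_ge_atTop 2] with k hk
  have hk' : (1 : ℝ) < k := by exact_mod_cast hk
  rw [← EReal.coe_one, EReal.coe_le_coe_iff, Real.le_logb_iff_rpow_le hk', Real.rpow_one]
  · exact_mod_cast le_finrank_pow_smul hM h k
  · exact_mod_cast (by omega : 0 < k).trans_le (le_finrank_pow_smul hM h k)

end GelfandKirillov

/-! ### The dimension and growth of `F_λ` -/

section Dimension

open Polynomial

theorem one_mem_ueOne (α : ℂ) : (1 : UE α) ∈ ueOne α :=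
  Submodule.mem_sup_left (Submodule.one_le.1 le_rfl)

theorem ueι_mem_ueOne (α : ℂ) (X : G α) : ueι α X ∈ ueOne α :=
  Submodule.mem_sup_right ⟨X, rfl⟩

theorem adjoin_ueOne (α : ℂ) : Algebra.adjoin ℂ (ueOne α : Set (UE α)) = ⊤ := by
  rw [eq_top_iff]
  have h : (Algebra.adjoin ℂ (Set.range (TensorAlgebra.ι ℂ : G α → _))).map
      (RingQuot.mkAlgHom ℂ (UERel α)) = ⊤ := by
    rw [TensorAlgebra.adjoin_range_ι, Algebra.map_top, AlgHom.range_eq_top]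
    exact RingQuot.mkAlgHom_surjective ℂ (UERel α)
  rw [← h, AlgHom.map_adjoin]
  refine Algebra.adjoin_mono ?_
  rintro _ ⟨_, ⟨X, rfl⟩, rfl⟩
  exact ueι_mem_ueOne α X

variable {α lam ν κ : ℂ} {t s : Fin 4} {Q : P →ₗ[ℂ] FockModel}
  {Φ : UE α →ₐ[ℂ] Module.End ℂ (Fock α lam)}

/-- The embedding of the module `F_λ` into the model. -/
def IsModel.emb (h : IsModel α lam ν κ t s Q) (Φ : UE α →ₐ[ℂ] Module.End ℂ (Fock α lam)) :
    F Φ →ₗ[ℂ] FockModel where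
  toFun x := h.proj (show Fock α lam from (x : FockMod Φ))
  map_add' _ _ := h.proj.map_add _ _
  map_smul' _ _ := h.proj.map_smul _ _

theorem IsModel.emb_injective (h : IsModel α lam ν κ t s Q) :
    Function.Injective (h.emb Φ) :=
  fun _ _ hxy => Subtype.ext (h.proj_injective hxy)

theorem IsModel.emb_smul (h : IsModel α lam ν κ t s Q) (hΦ : IsFockAction α lam Φ) (X : G α)
    (x : F Φ) : h.emb Φ (ueι α X • x) = modelRep ν κ t s (cayley α X) (h.emb Φ x) :=
  h.proj_action hΦ X _

theorem modelFil_zero : modelFil 0 = Submodule.span ℂ {modelVac} := by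
  refine le_antisymm (fun n hn => ?_)
    ((Submodule.span_singleton_le_iff_mem _ _).2 (modelVac_mem_modelFil 0))
  obtain ⟨h0, h1, h2, h3⟩ := mem_modelFil.1 hn
  rw [mem_degreeLT] at h0 h1 h2 h3
  have hz : ∀ f : ℂ[X], f.degree < ((0 : ℕ) : WithBot ℕ) → f = 0 := fun f hf =>
    degree_eq_bot.1 (Nat.WithBot.lt_zero_iff.1 (by exact_mod_cast hf))
  have hc : n 0 = C ((n 0).coeff 0) :=
    eq_C_of_degree_le_zero (Nat.WithBot.lt_one_iff_le_zero.1 (by simpa using h0))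
  refine Submodule.mem_span_singleton.2 ⟨(n 0).coeff 0, ?_⟩
  funext i
  fin_cases i
  · simpa [modelVac, smul_eq_C_mul] using hc.symm
  · simpa [modelVac] using (hz _ h1).symm
  · simpa [modelVac] using (hz _ h2).symm
  · simpa [modelVac] using (hz _ h3).symm

theorem ueOne_pow_succ_smul (k : ℕ) :
    (ueOne α ^ (k + 1) • FZero Φ : Submodule ℂ (F Φ)) = ueOne α • (ueOne α ^ k • FZero Φ) := by
  rw [pow_succ', ← smul_eq_mul, Submodule.smul_assoc]

/-- The canonical filtration becomes the degree filtration. One inclusion holds because the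
operators raise the degree by at most one; the other because the coordinates, acting as elements of
`D_α⁻`, produce each degree from the preceding one. -/
theorem IsModel.map_emb (h : IsModel α lam ν κ t s Q) (hΦ : IsFockAction α lam Φ) (k : ℕ) :
    (ueOne α ^ k • FZero Φ : Submodule ℂ (F Φ)).map (h.emb Φ) = modelFil k := by
  induction k with
  | zero =>
    have hv : h.emb Φ ⟨vac Φ, Submodule.mem_span_singleton_self (vac Φ)⟩ = modelVac :=
      (h.proj_mk 1).trans h.map_one
    rw [pow_zero, Submodule.one_smul, FZero, Submodule.map_span, Set.image_singleton, hv,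
      modelFil_zero]
  | succ k ih =>
    rw [ueOne_pow_succ_smul]
    apply le_antisymm
    · rw [Submodule.map_le_iff_le_comap, Submodule.smul_le]
      intro r hr x hx
      obtain ⟨a, ha, _, ⟨X, rfl⟩, rfl⟩ := Submodule.mem_sup.1 hr
      obtain ⟨c, rfl⟩ := Submodule.mem_one.1 ha
      have hx' : h.emb Φ x ∈ modelFil k := ih ▸ Submodule.mem_map_of_mem hx
      rw [Submodule.mem_comap, add_smul, map_add, algebraMap_smul, map_smul, h.emb_smul hΦ]
      exact add_mem (modelFil_mono k (Submodule.smul_mem _ _ hx'))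
        (modelRep_mem_modelFil _ _ _ _ _ hx')
    · refine mem_of_mem_modelFil_succ h.params (fun X n hn => ?_) ?_
      · rw [← ih] at hn
        obtain ⟨x, hx, rfl⟩ := hn
        -- An element of `𝔤` acts on `F_λ` through its Cayley transform, so the operator of `X` in
        -- the model is realised by a preimage `Y`.
        obtain ⟨Y, rfl⟩ := cayley_surjective α X
        rw [← h.emb_smul hΦ]
        exact Submodule.mem_map_of_mem (Submodule.smul_mem_smul (ueι_mem_ueOne α Y) hx)
      · rw [← ih]
        refine Submodule.map_mono fun x hx => ?_
        simpa using Submodule.smul_mem_smul (one_mem_ueOne α) hx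

theorem IsModel.finrank_pow_smul (h : IsModel α lam ν κ t s Q) (hΦ : IsFockAction α lam Φ)
    (k : ℕ) : Module.finrank ℂ (ueOne α ^ k • FZero Φ : Submodule ℂ (F Φ)) = 1 + 4 * k := by
  rw [← finrank_modelFil, ← h.map_emb hΦ]
  exact (LinearEquiv.finrank_eq (Submodule.equivMapOfInjective _ h.emb_injective _))

theorem isGKPair_ueOne (Φ : UE α →ₐ[ℂ] Module.End ℂ (Fock α lam)) :
    IsGKPair (M := F Φ) (ueOne α) (FZero Φ) where
  finite_left := Module.Finite.iff_fg.2 <| by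
    refine Submodule.FG.sup ?_ ?_
    · rw [Submodule.one_eq_span]
      exact Submodule.fg_span_singleton 1
    · rw [LinearMap.range_eq_map]
      exact Submodule.FG.map _ Module.Finite.fg_top
  one_mem := one_mem_ueOne α
  adjoin_eq_top := adjoin_ueOne α
  finite_right := Module.Finite.iff_fg.2 (Submodule.fg_span_singleton _)
  span_eq_top := by
    rw [eq_top_iff]
    rintro ⟨x, hx⟩ -
    obtain ⟨r, rfl⟩ := Submodule.mem_span_singleton.1 hx
    exact Submodule.smul_mem _ r (Submodule.subset_span (Submodule.mem_span_singleton_self _))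

theorem IsModel.not_finiteDimensional (h : IsModel α lam ν κ t s Q)
    (hΦ : IsFockAction α lam Φ) : ¬ FiniteDimensional ℂ (F Φ) := fun hfin => by
  -- Taking `k` equal to the supposed dimension `d` yields a subspace of dimension `1 + 4d > d`.
  have := Submodule.finrank_le (ueOne α ^ Module.finrank ℂ (F Φ) • FZero Φ : Submodule ℂ (F Φ))
  rw [h.finrank_pow_smul hΦ] at this
  omega

theorem IsModel.hasGKDim (h : IsModel α lam ν κ t s Q) (hΦ : IsFockAction α lam Φ) :
    HasGKDim (UE α) (F Φ) 1 := by
  have hp := isGKPair_ueOne Φ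
  refine ⟨⟨_, _, hp⟩, fun V F₀ hV => le_antisymm ?_
    (one_le_gkGrowth (h.not_finiteDimensional hΦ) hV)⟩
  -- The constant 4 comes from `1 + 4k ≤ 4(k + 1)`.
  refine gkGrowth_le_one_of_filtration hp.one_mem hp.adjoin_eq_top (exists_mem_pow_smul hp)
    (fg_pow_smul hp) 4 (fun k => ?_) hV
  rw [h.finrank_pow_smul hΦ]
  omega

end Dimension

end D21

end

theorem mainTheorem7 (α lam : ℂ) (hα : α ≠ 0)
    (h : (lam = α ∧ ∀ n : ℕ, α ≠ n) ∨ (lam = 1 ∧ ∀ n : ℕ, α⁻¹ ≠ n)) :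
    ∃ Φ : D21.UE α →ₐ[ℂ] Module.End ℂ (D21.Fock α lam),
      D21.IsFockAction α lam Φ ∧
      (∀ Ψ : D21.UE α →ₐ[ℂ] Module.End ℂ (D21.Fock α lam),
        D21.IsFockAction α lam Ψ → Ψ = Φ) ∧
      D21.HasGKDim (D21.UE α) (D21.F Φ) 1 ∧
      (∀ k : ℕ, Module.finrank ℂ
        (D21.ueOne α ^ k • D21.FZero Φ : Submodule ℂ (D21.F Φ)) = 1 + 4 * k) ∧
      ¬ FiniteDimensional ℂ (D21.F Φ) ∧
      (∀ (M : Type*) [AddCommGroup M] [Module ℂ M] [Module (D21.UE α) M]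
        [IsScalarTower ℂ (D21.UE α) M] (V : Submodule ℂ (D21.UE α)) (M₀ : Submodule ℂ M),
        ¬ FiniteDimensional ℂ M → D21.IsGKPair V M₀ → 1 ≤ D21.gkGrowth V M₀) := by
  obtain ⟨ν, κ, t, s, Q, hQ⟩ := D21.exists_isModel hα h
  have hΦ := hQ.isFockAction
  exact ⟨hQ.action, hΦ, fun _ hΨ => hΦ.unique hΨ, hQ.hasGKDim hΦ, hQ.finrank_pow_smul hΦ,
    hQ.not_finiteDimensional hΦ, fun _ _ _ _ _ _ _ => D21.one_le_gkGrowth⟩
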